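/- **Conventions.** Let $\Delta$ be the simplex category and $p:\mathrm{Cat}\to\mathrm{Set}$ the functor sending a small category to its set of isomorphism classes of objects. All structures below are objects of $[(\Delta^{n-1})^{op},\mathrm{Cat}]$, $n\ge 1$; for $n\ge2$ such an $X$ is a simplicial object $k\mapsto X_k$ of $[(\Delta^{n-2})^{op},\mathrm{Cat}]$. The multinerve $N_n:[(\Delta^{n-1})^{op},\mathrm{Cat}]\to[(\Delta^{n})^{op},\mathrm{Set}]$ takes the nerve levelwise; it is fully faithful. For $n\ge 2$, when the levelwise application $\bar pX$ of $p$ to $X$ is isomorphic to the multinerve of an object of $[(\Delta^{n-2})^{op},\mathrm{Cat}]$, that object is denoted $p^{(n)}X$. We call $X$ *discrete* if its multinerve is (isomorphic to) a constant functor. *Homotopically discrete $n$-fold categories* $\mathrm{Cat}_{hd}^n$: for $n=1$, the equivalence relations (groupoids with at most one arrow between any two objects). For $n\geq 2$, $X\in \mathrm{Cat}_{hd}^n$ iff $X_k\in\mathrm{Cat}_{hd}^{n-1}$ for all $k\ge0$, the Segal maps $X_k\to X_1\times_{X_0}\cdots\times_{X_0}X_1$ are isomorphisms for $k\ge2$,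 and $p^{(n)}X$ exists and lies in $\mathrm{Cat}_{hd}^{n-1}$. For such $X$ the *discretization* $X^d$ is the discrete object on the set $p^{(1)}p^{(2)}\cdots p^{(n)}X$ (where $p^{(1)}=p$), and the *discretization map* $\gamma:X\to X^d$ is the composite of the quotient maps $X\to p^{(n)}X\to p^{(n-1)}p^{(n)}X\to\cdots\to X^d$ (discrete inclusions suppressed). *Weakly globular $n$-fold categories* $\mathrm{Cat}_{wg}^n$ and *$n$-equivalences*: $\mathrm{Cat}_{wg}^1=\mathrm{Cat}$, and $1$-equivalences are equivalences of categories. For $n\ge2$, $X\in\mathrm{Cat}_{wg}^n$ iff $X_k\in \mathrm{Cat}_{wg}^{n-1}$ for all $k\ge 0$; $X_0\in \mathrm{Cat}_{hd}^{n-1}$; the Segal maps $X_k\to X_1\times_{X_0}\cdots\times_{X_0}X_1$ are isomorphisms for $k\ge 2$; the induced Segal maps $X_k\to X_1\times_{X_0^d}\cdots\times_{X_0^d}X_1$ are $(n-1)$-equivalences for $k\ge2$; and $p^{(n)}X$ exists and lies in $\mathrm{Cat}_{wg}^{n-1}$. Morphisms are all morphisms of $[(\Delta^{n-1})^{op},\mathrm{Cat}]$.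 For $a,b\in X_0^d$ let $X(a,b)$ be the fibre over $(a,b)$ of $X_1\xrightarrow{(d_0,d_1)}X_0\times X_0\xrightarrow{\gamma\times\gamma}X_0^d\times X_0^d$. A morphism $f:X\to Y$ is an $n$-equivalence iff $f(a,b):X(a,b)\to Y(fa,fb)$ is an $(n-1)$-equivalence for all $a,b\in X_0^d$ and $p^{(n)}f$ is an $(n-1)$-equivalence. **Statement.** For every $n\ge 2$ there are a functor $F_n:\mathrm{Cat}_{wg}^n\to\mathrm{Cat}_{wg}^n$ and a natural transformation with components $V_X:F_nX\to X$ such that: (i) $V_X$ is an $n$-equivalence for every $X\in\mathrm{Cat}_{wg}^n$. (ii) $F_n$ is the identity on discrete objects: $F_nX=X$ and $V_X=\mathrm{id}_X$ if $X$ is discrete. Moreover $F_n$ preserves pullbacks over discrete objects: it preserves the pullback of every diagram $X\to Z\leftarrow Y$ in $\mathrm{Cat}_{wg}^n$ with $Z$ discrete. (iii) There is a choice, for every $X\in\mathrm{Cat}_{wg}^n$, of a section $s_X:(F_nX)_0^d\to(F_nX)_0$ of the discretization map, $\gamma s_X=\mathrm{id}$, such that for every morphism $f:X\to Y$ of $\mathrm{Cat}_{wg}^n$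 $$ (F_nf)_0\circ s_X \;=\; s_Y\circ (F_nf)_0^d .$$ -/

import Mathlib

open CategoryTheory CategoryTheory.Limits Opposite

universe u

namespace WGlob

noncomputable section

/-! ### Multi-simplicial sets and multi-simplicial categories -/

/-- The categories `MSSet m` below, by recursion on `m`. -/
def msSetCat : ℕ → Cat.{u, u + 1}
  | 0 => Cat.of (Type u)
  | m + 1 => Cat.of (SimplicialObject (msSetCat m))

/-- `MSSet m` is the category `[(Δᵐ)ᵒᵖ, Set]` of `m`-fold simplicial sets, presented as iterated
simplicial objects (the outermost simplicial direction is the first one). -/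
def MSSet (m : ℕ) : Type (u + 1) := msSetCat.{u} m

instance instCategoryMSSet (m : ℕ) : Category.{u} (MSSet.{u} m) := (msSetCat.{u} m).str

/-- The categories `MSCat m` below, by recursion on `m`. -/
def msCatCat : ℕ → Cat.{u, u + 1}
  | 0 => Cat.of Cat.{u, u}
  | m + 1 => Cat.of (SimplicialObject (msCatCat m))

/-- `MSCat m` is the category `[(Δᵐ)ᵒᵖ, Cat]` of `m`-fold simplicial small categories, presented as
iterated simplicial objects (the outermost simplicial direction is the first one).
The categories of `n`-fold structures with `n = m + 1 ≥ 1` are full subcategories of `MSCat m`: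
the last of the `n` directions is the categorical one. -/
def MSCat (m : ℕ) : Type (u + 1) := msCatCat.{u} m

instance instCategoryMSCat (m : ℕ) : Category.{u} (MSCat.{u} m) := (msCatCat.{u} m).str

instance instHasLimitsMSCat : ∀ m : ℕ, HasLimits (MSCat.{u} m)
  | 0 => inferInstanceAs (HasLimits Cat.{u, u})
  | m + 1 =>
    have := instHasLimitsMSCat m
    inferInstanceAs (HasLimits (SimplexCategoryᵒᵖ ⥤ MSCat.{u} m))

instance instHasSmallLimitsMSCat (m : ℕ) : HasLimitsOfSize.{0, 0} (MSCat.{u} m) :=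
  hasLimitsOfSizeShrink.{0, 0, u, u} _

/-- An object of `MSCat (m + 1)` as a simplicial object in `MSCat m`, along the first direction. -/
def toSimp (m : ℕ) : MSCat.{u} (m + 1) ⥤ SimplicialObject (MSCat.{u} m) := 𝟭 _

/-- `X ↦ X_k`, evaluation of the first simplicial direction at `[k]`. -/
def lev (m k : ℕ) : MSCat.{u} (m + 1) ⥤ MSCat.{u} m :=
  toSimp m ⋙ (evaluation _ _).obj (op (SimplexCategory.mk k))

/-- The face maps `d_0, d_1 : X_1 ⟶ X_0` of the first simplicial direction. -/
def face (m : ℕ) (i : Fin 2) : lev.{u} m 1 ⟶ lev.{u} m 0 :=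
  Functor.whiskerLeft (toSimp m) ((evaluation _ _).map (SimplexCategory.δ i).op)

/-- `p` (isomorphism classes of objects) applied levelwise. -/
def pBar : ∀ m : ℕ, MSCat.{u} m ⥤ MSSet.{u} m
  | 0 => isomorphismClasses.{u, u}
  | m + 1 => (SimplicialObject.whiskering (MSCat.{u} m) (MSSet.{u} m)).obj (pBar m)

/-- The discrete category functor `Set ⥤ Cat` applied levelwise. -/
def dBar : ∀ m : ℕ, MSSet.{u} m ⥤ MSCat.{u} m
  | 0 => typeToCat.{u}
  | m + 1 => (SimplicialObject.whiskering (MSSet.{u} m) (MSCat.{u} m)).obj (dBar m)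

/-- The multinerve: the nerve of the last, categorical, direction is taken levelwise. -/
def multinerve : ∀ m : ℕ, MSCat.{u} m ⥤ MSSet.{u} (m + 1)
  | 0 => nerveFunctor.{u, u}
  | m + 1 => (SimplicialObject.whiskering (MSCat.{u} m) (MSSet.{u} (m + 1))).obj (multinerve m)

/-- The left adjoint of the multinerve (`SSet.hoFunctor` along the last direction). Since the
multinerve is fully faithful, this recovers an object from its multinerve. -/
def unnerve : ∀ m : ℕ, MSSet.{u} (m + 1) ⥤ MSCat.{u} m
  | 0 => SSet.hoFunctor.{u}
  | m + 1 => (SimplicialObject.whiskering (MSSet.{u} (m + 1)) (MSCat.{u} m)).obj (unnerve m)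

/-- The unit of the adjunction `unnerve m ⊣ multinerve m`, that is, the unit of
`SSet.hoFunctor ⊣ nerveFunctor` levelwise. Its component at `S` is an isomorphism if and only if
`S` is isomorphic to a multinerve. -/
def nerveUnit : ∀ m : ℕ, 𝟭 (MSSet.{u} (m + 1)) ⟶ unnerve.{u} m ⋙ multinerve.{u} m
  | 0 => nerveAdjunction.{u}.unit
  | m + 1 =>
    ((SimplicialObject.whiskering (MSSet.{u} (m + 1)) (MSSet.{u} (m + 1))).map (nerveUnit m) :)

/-- The truncation `p⁽ⁿ⁾` (for `n = m + 2`), given by `(p⁽ⁿ⁾ X)_s = p (X_s)` at the level of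
multinerves: apply `p` levelwise, and regard the resulting `(n-1)`-fold simplicial set as an
`(n-1)`-fold structure. -/
def trunc (m : ℕ) : MSCat.{u} (m + 1) ⥤ MSCat.{u} m := pBar (m + 1) ⋙ unnerve m

/-- The comparison map from `p` applied levelwise to `X` to the multinerve of `p⁽ⁿ⁾ X`. -/
def truncUnit (m : ℕ) : pBar.{u} (m + 1) ⟶ trunc.{u} m ⋙ multinerve.{u} m :=
  Functor.whiskerLeft (pBar (m + 1)) (nerveUnit m)

/-- `p` applied levelwise to `X` is a multinerve, namely that of `p⁽ⁿ⁾ X`. -/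
def HasTruncation (m : ℕ) (X : MSCat.{u} (m + 1)) : Prop := IsIso ((truncUnit m).app X)

/-! ### Segal maps -/

section Segal

variable {C : Type*} [Category* C]

/-- The shape of the diagram whose limit is `X₁ ×_B ⋯ ×_B X₁` (`k` factors `X₁`, indexed by
`0, …, k - 1`, and `k - 1` copies of `B`). -/
abbrev zigzagShape (k : ℕ) : MulticospanShape where
  L := Fin k
  R := Fin (k - 1)
  fst j := ⟨j, by omega⟩
  snd j := ⟨j + 1, by omega⟩

/-- The diagram `X₁ → B ← X₁ → B ← ⋯ ← X₁`, with maps `γ d₀` (pointing right) and `γ d₁`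
(pointing left). -/
abbrev zigzag (X : SimplicialObject C) {B : C} (γ : X.obj (op (SimplexCategory.mk 0)) ⟶ B) (k : ℕ) :
    MulticospanIndex (zigzagShape k) C where
  left _ := X.obj (op (SimplexCategory.mk 1))
  right _ := B
  fst _ := X.δ 0 ≫ γ
  snd _ := X.δ 1 ≫ γ

/-- The map `ν_j : X_k ⟶ X_1` induced by `[1] ⟶ [k]`, `0 ↦ j`, `1 ↦ j + 1`. -/
def nu (X : SimplicialObject C) {k : ℕ} (j : Fin k) :
    X.obj (op (SimplexCategory.mk k)) ⟶ X.obj (op (SimplexCategory.mk 1)) :=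
  X.map (SimplexCategory.mkOfSucc j).op

lemma nu_comp (X : SimplicialObject C) {k : ℕ} (j : Fin (k - 1)) :
    nu X (⟨j, by omega⟩ : Fin k) ≫ X.δ 0 = nu X (⟨j + 1, by omega⟩ : Fin k) ≫ X.δ 1 := by
  simp only [nu, SimplicialObject.δ, ← X.map_comp, ← op_comp]
  congr 2
  ext i
  fin_cases i
  simp

variable [HasLimitsOfSize.{0, 0} C]

/-- The `k`-fold fibre product `X₁ ×_B ⋯ ×_B X₁`. -/
def fibrePower (X : SimplicialObject C) {B : C} (γ : X.obj (op (SimplexCategory.mk 0)) ⟶ B)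
    (k : ℕ) : C :=
  multiequalizer (zigzag X γ k)

/-- The `k`-th Segal map induced by `γ : X₀ ⟶ B`, that is, the map
`X_k ⟶ X₁ ×_B ⋯ ×_B X₁` with components `ν_j`. -/
def inducedSegalMap (X : SimplicialObject C) {B : C}
    (γ : X.obj (op (SimplexCategory.mk 0)) ⟶ B) (k : ℕ) :
    X.obj (op (SimplexCategory.mk k)) ⟶ fibrePower X γ k :=
  Multiequalizer.lift (zigzag X γ k) _ (fun j => nu X j) (fun j => by
    have h := nu_comp X j
    dsimp
    rw [← Category.assoc, ← Category.assoc, h])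

/-- The Segal condition: all Segal maps `X_k ⟶ X₁ ×_{X₀} ⋯ ×_{X₀} X₁`, `k ≥ 2`, are
isomorphisms. -/
def IsSegal (X : SimplicialObject C) : Prop :=
  ∀ k : ℕ, 2 ≤ k → IsIso (inducedSegalMap X (𝟙 _) k)

end Segal

/-! ### Homotopically discrete `n`-fold categories -/

/-- Equivalence relations, that is, groupoids with at most one morphism between any two objects. -/
def IsEquivRel (C : Cat.{u, u}) : Prop := (∀ x y : C, Subsingleton (x ⟶ y)) ∧ IsGroupoid C

/-- Homotopically discrete `n`-fold categories, `n = m + 1`. -/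
def IsHomDisc : ∀ m : ℕ, MSCat.{u} m → Prop
  | 0, C => IsEquivRel C
  | m + 1, X => (∀ k : ℕ, IsHomDisc m ((lev m k).obj X)) ∧ IsSegal ((toSimp m).obj X) ∧
      HasTruncation m X ∧ IsHomDisc m ((trunc m).obj X)

/-- The category `C` is a groupoid. -/
def IsGpd (C : Cat.{u, u}) : Prop := IsGroupoid C

/-- All the categories `X_s` are groupoids. -/
def LevelGroupoid : ∀ m : ℕ, MSCat.{u} m → Prop
  | 0, C => IsGpd C
  | m + 1, X => ∀ k : ℕ, LevelGroupoid m ((lev m k).obj X)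

lemma IsHomDisc.levelGroupoid : ∀ {m : ℕ} {X : MSCat.{u} m}, IsHomDisc m X → LevelGroupoid m X
  | 0, _, h => h.2
  | _ + 1, _, h => fun k => (h.1 k).levelGroupoid

/-- For a groupoid `C`, the functor from `C` to the discrete category on `p C` which sends an object
to its isomorphism class. -/
def toClasses (C : Cat.{u, u}) (h : IsGpd C) :
    C ⟶ typeToCat.obj (isomorphismClasses.obj C) :=
  have : IsGroupoid C := h
  Functor.toCatHom
    { obj := fun x => Discrete.mk (Quotient.mk (isIsomorphicSetoid C) x)
      map := fun f => Discrete.eqToHom (Quotient.sound ⟨asIso f⟩)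
      map_id := fun _ => Subsingleton.elim _ _
      map_comp := fun _ _ => Subsingleton.elim _ _ }

lemma toClasses_naturality {C D : Cat.{u, u}} (hC : IsGpd C) (hD : IsGpd D) (F : C ⟶ D) :
    F ≫ toClasses D hD = toClasses C hC ≫ typeToCat.map (isomorphismClasses.map F) := by
  apply Cat.Hom.ext
  refine CategoryTheory.Functor.ext (fun x => rfl) (fun x y f => Subsingleton.elim (α := (_ : Discrete _) ⟶ _) _ _)

/-- The maps `X_s ⟶ d p X_s` for a levelwise groupoidal `X`, together with their naturality. -/
def toClassesBarAux : ∀ m : ℕ,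
    { t : ∀ X : MSCat.{u} m, LevelGroupoid m X → (X ⟶ (dBar m).obj ((pBar m).obj X)) //
      ∀ (X Y : MSCat.{u} m) (hX : LevelGroupoid m X) (hY : LevelGroupoid m Y) (f : X ⟶ Y),
        f ≫ t Y hY = t X hX ≫ (dBar m).map ((pBar m).map f) }
  | 0 => ⟨fun C h => toClasses C h, fun _ _ hX hY f => toClasses_naturality hX hY f⟩
  | m + 1 => ⟨fun _ hX =>
      { app := fun k => (toClassesBarAux m).1 _ (hX k.unop.len)
        naturality := fun _ _ _ => (toClassesBarAux m).2 _ _ _ _ _ },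
      fun _ _ hX hY f =>
        NatTrans.ext (funext fun k => (toClassesBarAux m).2 _ _ (hX k.unop.len) (hY k.unop.len)
          (((toSimp m).map f).app k))⟩

/-- The map `X ⟶ d p X` (levelwise) for a levelwise groupoidal `X`. -/
def toClassesBar (m : ℕ) (X : MSCat.{u} m) (h : LevelGroupoid m X) :
    X ⟶ (dBar m).obj ((pBar m).obj X) :=
  (toClassesBarAux m).1 X h

lemma toClassesBar_naturality {m : ℕ} {X Y : MSCat.{u} m} (hX : LevelGroupoid m X)
    (hY : LevelGroupoid m Y) (f : X ⟶ Y) :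
    f ≫ toClassesBar m Y hY = toClassesBar m X hX ≫ (dBar m).map ((pBar m).map f) :=
  (toClassesBarAux m).2 X Y hX hY f

/-- The discrete inclusion `d⁽ⁿ⁾` of `(n-1)`-fold into `n`-fold structures, `n = m + 2`: the new,
last, direction is discrete. -/
def dIncl (m : ℕ) : MSCat.{u} m ⥤ MSCat.{u} (m + 1) := multinerve m ⋙ dBar (m + 1)

/-- `d⁽ⁿ⁾ ⋯ d⁽¹⁾`, the discrete `n`-fold category on a set, `n = m + 1`. -/
def disc : ∀ m : ℕ, Type u ⥤ MSCat.{u} m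
  | 0 => typeToCat.{u}
  | m + 1 => disc m ⋙ dIncl m

/-- The set `p⁽¹⁾ ⋯ p⁽ⁿ⁾ X`, `n = m + 1`. -/
def classes : ∀ m : ℕ, MSCat.{u} m ⥤ Type u
  | 0 => isomorphismClasses.{u, u}
  | m + 1 => trunc m ⋙ classes m

/-- The discretization `X^d = d⁽ⁿ⁾ ⋯ d⁽¹⁾ p⁽¹⁾ ⋯ p⁽ⁿ⁾ X`, `n = m + 1`. -/
def discretization (m : ℕ) : MSCat.{u} m ⥤ MSCat.{u} m := classes m ⋙ disc m

/-- The map `γ⁽ⁿ⁾ : X ⟶ d⁽ⁿ⁾ p⁽ⁿ⁾ X`, `n = m + 2`, for homotopically discrete `X`. -/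
def gammaStep (m : ℕ) (X : MSCat.{u} (m + 1)) (h : IsHomDisc (m + 1) X) :
    X ⟶ (dIncl m).obj ((trunc m).obj X) :=
  toClassesBar (m + 1) X h.levelGroupoid ≫ (dBar (m + 1)).map ((truncUnit m).app X)

/-- The discretization map `γ : X ⟶ X^d` of a homotopically discrete `X`, that is, the composite
`X ⟶ d⁽ⁿ⁾ p⁽ⁿ⁾ X ⟶ d⁽ⁿ⁾ d⁽ⁿ⁻¹⁾ p⁽ⁿ⁻¹⁾ p⁽ⁿ⁾ X ⟶ ⋯ ⟶ X^d`. -/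
def gamma : ∀ (m : ℕ) (X : MSCat.{u} m), IsHomDisc m X → (X ⟶ (discretization m).obj X)
  | 0, X, h => toClasses X h.2
  | m + 1, X, h => gammaStep m X h ≫ (dIncl m).map (gamma m ((trunc m).obj X) h.2.2.2)

lemma paste_squares {C : Type*} [Category* C] {X₁ X₂ X₃ X₄ Y₁ Y₂ Y₃ Y₄ : C} {a₁ : X₁ ⟶ X₂}
    {a₂ : X₂ ⟶ X₃} {a₃ : X₃ ⟶ X₄} {b₁ : Y₁ ⟶ Y₂} {b₂ : Y₂ ⟶ Y₃} {b₃ : Y₃ ⟶ Y₄} {f₁ : X₁ ⟶ Y₁}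
    {f₂ : X₂ ⟶ Y₂} {f₃ : X₃ ⟶ Y₃} {f₄ : X₄ ⟶ Y₄} (h₁ : f₁ ≫ b₁ = a₁ ≫ f₂)
    (h₂ : f₂ ≫ b₂ = a₂ ≫ f₃) (h₃ : f₃ ≫ b₃ = a₃ ≫ f₄) :
    f₁ ≫ (b₁ ≫ b₂) ≫ b₃ = ((a₁ ≫ a₂) ≫ a₃) ≫ f₄ := by
  simp only [Category.assoc]
  rw [reassoc_of% h₁, reassoc_of% h₂, h₃]

lemma map_square {C D : Type*} [Category* C] [Category* D] (F : C ⥤ D) {X₁ X₂ Y₁ Y₂ : C}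
    {a : X₁ ⟶ X₂} {b : Y₁ ⟶ Y₂} {f : X₁ ⟶ Y₁} {g : X₂ ⟶ Y₂} (h : f ≫ b = a ≫ g) :
    F.map f ≫ F.map b = F.map a ≫ F.map g := by
  rw [← F.map_comp, h, F.map_comp]

lemma gamma_naturality : ∀ {m : ℕ} {X Y : MSCat.{u} m} (hX : IsHomDisc m X) (hY : IsHomDisc m Y)
    (f : X ⟶ Y), f ≫ gamma m Y hY = gamma m X hX ≫ (discretization m).map f
  | 0, _, _, hX, hY, f => toClasses_naturality hX.2 hY.2 f
  | m + 1, _, _, hX, hY, f =>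
    paste_squares (toClassesBar_naturality hX.levelGroupoid hY.levelGroupoid f)
      (map_square (dBar (m + 1)) ((truncUnit m).naturality f))
      (map_square (dIncl m) (gamma_naturality hX.2.2.2 hY.2.2.2 ((trunc m).map f)))

/-! ### Hom objects and `n`-equivalences -/

/-- The map `X₁ ⟶ X₀ × X₀ ⟶ X₀^d × X₀^d`, with components `γ d_0` and `γ d_1`. -/
def endpoints (m : ℕ) (X : MSCat.{u} (m + 1)) (h : IsHomDisc m ((lev m 0).obj X)) :
    (lev m 1).obj X ⟶
      (discretization m).obj ((lev m 0).obj X) ⨯ (discretization m).obj ((lev m 0).obj X) :=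
  prod.lift ((face m 0).app X ≫ gamma m _ h) ((face m 1).app X ≫ gamma m _ h)

/-- The point of the discrete object `Z^d` given by `a`. -/
def point (m : ℕ) {Z : MSCat.{u} m} (a : (classes m).obj Z) :
    (disc m).obj PUnit.{u + 1} ⟶ (discretization m).obj Z :=
  (disc m).map (↾fun _ => a)

/-- The object `X(a, b)`: the fibre of `X₁ ⟶ X₀^d × X₀^d` at `(a, b)`. -/
def homObj (m : ℕ) (X : MSCat.{u} (m + 1)) (h : IsHomDisc m ((lev m 0).obj X))
    (a b : (classes m).obj ((lev m 0).obj X)) : MSCat.{u} m :=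
  pullback (endpoints m X h) (prod.lift (point m a) (point m b))

lemma endpoints_naturality (m : ℕ) {X Y : MSCat.{u} (m + 1)}
    (hX : IsHomDisc m ((lev m 0).obj X)) (hY : IsHomDisc m ((lev m 0).obj Y)) (f : X ⟶ Y) :
    endpoints m X hX ≫ prod.map ((discretization m).map ((lev m 0).map f))
      ((discretization m).map ((lev m 0).map f)) = (lev m 1).map f ≫ endpoints m Y hY := by
  have g := gamma_naturality hX hY ((lev m 0).map f)
  unfold endpoints
  rw [prod.lift_map, prod.comp_lift]
  simp only [Category.assoc, ← g, NatTrans.naturality_assoc]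

lemma point_comp (m : ℕ) {Z W : MSCat.{u} m} (a : (classes m).obj Z) (f : Z ⟶ W) :
    point m a ≫ (discretization m).map f = point m ((classes m).map f a) := by
  change (disc m).map _ ≫ (disc m).map _ = (disc m).map _
  rw [← (disc m).map_comp]
  rfl

/-- The map `f(a, b) : X(a, b) ⟶ Y(f a, f b)`. -/
def homMap (m : ℕ) {X Y : MSCat.{u} (m + 1)} (hX : IsHomDisc m ((lev m 0).obj X))
    (hY : IsHomDisc m ((lev m 0).obj Y)) (f : X ⟶ Y)
    (a b : (classes m).obj ((lev m 0).obj X)) :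
    homObj m X hX a b ⟶ homObj m Y hY ((classes m).map ((lev m 0).map f) a)
      ((classes m).map ((lev m 0).map f) b) :=
  pullback.map _ _ _ _ ((lev m 1).map f) (𝟙 _)
    (prod.map ((discretization m).map ((lev m 0).map f))
      ((discretization m).map ((lev m 0).map f)))
    (endpoints_naturality m hX hY f)
    (by rw [Category.id_comp, prod.lift_map, point_comp, point_comp])

/-- Equivalences of categories. -/
def IsCatEquiv {C D : Cat.{u, u}} (F : C ⟶ D) : Prop := F.toFunctor.IsEquivalence

/-- `n`-equivalences, `n = m + 1`. For `n > 1` the objects `X₀`, `Y₀` have to be homotopically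
discrete for the objects `X(a, b)`, `Y(f a, f b)` to make sense. -/
def IsNEquiv : ∀ (m : ℕ) {X Y : MSCat.{u} m}, (X ⟶ Y) → Prop
  | 0, _, _, f => IsCatEquiv f
  | m + 1, X, Y, f =>
    ∃ (hX : IsHomDisc m ((lev m 0).obj X)) (hY : IsHomDisc m ((lev m 0).obj Y)),
      (∀ a b, IsNEquiv m (homMap m hX hY f a b)) ∧ IsNEquiv m ((trunc m).map f)

/-! ### Weakly globular `n`-fold categories -/

/-- Weakly globular `n`-fold categories, `n = m + 1`. -/
def IsWG : ∀ m : ℕ, ObjectProperty (MSCat.{u} m)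
  | 0 => fun _ => True
  | m + 1 => fun X =>
    (∀ k : ℕ, IsWG m ((lev m k).obj X)) ∧
    (∃ h : IsHomDisc m ((lev m 0).obj X),
      ∀ k : ℕ, 2 ≤ k → IsNEquiv m (inducedSegalMap ((toSimp m).obj X) (gamma m _ h) k)) ∧
    IsSegal ((toSimp m).obj X) ∧
    HasTruncation m X ∧ IsWG m ((trunc m).obj X)

/-- The category of weakly globular `n`-fold categories, `n = m + 1`, a full subcategory of
`[(Δⁿ⁻¹)ᵒᵖ, Cat]`. -/
abbrev CatWG (m : ℕ) : Type (u + 1) := (IsWG.{u} m).FullSubcategory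

/-- The constant `m`-fold simplicial sets. -/
def constSet : ∀ m : ℕ, Type u ⥤ MSSet.{u} m
  | 0 => 𝟭 (Type u)
  | m + 1 => constSet m ⋙ SimplicialObject.const (MSSet.{u} m)

/-- `X` is discrete: its multinerve is (isomorphic to) a constant functor. -/
def IsDiscreteObj (m : ℕ) (X : MSCat.{u} m) : Prop :=
  ∃ A : Type u, Nonempty ((multinerve m).obj X ≅ (constSet (m + 1)).obj A)

/-- The functor `X ↦ X_0`, with values in `(n-1)`-fold structures, on weakly globular `n`-fold categories, `n = m + 2`. -/
def levZero (m : ℕ) : CatWG.{u} (m + 1) ⥤ MSCat.{u} m := (IsWG.{u} (m + 1)).ι ⋙ lev m 0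

/-- For a weakly globular `X`, the object `X_0` is homotopically discrete. -/
lemma isHomDisc_levZero (m : ℕ) (X : CatWG.{u} (m + 1)) : IsHomDisc m ((levZero m).obj X) :=
  X.property.2.1.choose

end

end WGlob

/-!
For a weakly globular `X`, let `A` be the set underlying `X₀^d` and let `U` be the set of objects of
the category obtained by evaluating `X₀` at `0` in all its simplicial directions. The
discretization map `γ` sends `U` onto `A`; call this surjection `φ`. For a set `B`, let `C(B)` be
the codiscrete category on `B`, regarded as an `n`-fold structure which is discrete in all
directions but the first (`codiscIncl`). A map `X ⟶ C(A)` is the same thing as a map from `X₀` to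
the discrete object on `A`, so `γ` induces a natural map `X ⟶ C(A)`. The replacement of `X` is

  `F X = X ×_{C(A)} C(U)`,

and `V_X` is the first projection. It has the same hom objects as `X`, but each object of `X₀^d`
is replaced by all of its representatives.

* Truncations and hom objects commute with pullbacks over structures which come from a category
  (`isPullback_trunc`, `isPullback_homMapTo`), discretizations with pullbacks over discrete objects
  (`isPullback_discretization`), and fibre powers with all pullbacks (`isPullback_fibrePowerMap`).
  Hence weakly globular objects are stable under pullbacks over structures which come from a
  category, by an induction on `n` which simultaneously shows that `n`-equivalences are stable
  under pullbacks over discrete objects (`stability`). In particular `F X` is weakly globular.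
* As `φ` is surjective, `C(U) ⟶ C(A)` is an isomorphism on hom objects and its iterated truncation
  is an equivalence of categories with surjective object map. This is inherited by base changes, so
  that `V_X` is an `n`-equivalence (`isNEquiv_fst_of_isPullback_codiscIncl`).
* If `X` is discrete, then `φ` is bijective and `V_X` is an isomorphism. Transporting the values of
  `F` along these isomorphisms makes `F` the identity on discrete objects
  (`Replacement.exists_normalized`).
* The functors `U`, `A` and `C` preserve pullbacks over discrete objects, and pullbacks commute with
  pullbacks, so `F` does too (`Replacement.isPullback_map`).
* In degree `0`, `(F X)₀ = X₀ ×_A U`, with `A` and `U` discrete. So the classes of `(F X)₀` are in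
  bijection with `U`, and an element `x` of `U` gives the object `(x, x)` of `(F X)₀`. This is a
  section of the discretization map, and it is natural since no choice was made
  (`Replacement.levZeroSection`).
-/

namespace WGlob

noncomputable section

/-! ### Pullback squares -/

section Squares

variable {C : Type*} [Category* C]

/-- Limits commute with limits, for pullbacks: in a diagram `A ⟶ B ⟵ D` of commutative squares, if
the squares `A`, `B`, `D` are pullbacks, then so is the square of the pullbacks `E` of
`A ⟶ B ⟵ D`. The square `A` has corners `A₀ ⟶ A₁, A₂ ⟶ A₃`, and similarly for the others. -/
lemma isPullback_of_isPullbacks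
    {A₀ A₁ A₂ A₃ B₀ B₁ B₂ B₃ D₀ D₁ D₂ D₃ E₀ E₁ E₂ E₃ : C}
    {a₁ : A₀ ⟶ A₁} {a₂ : A₀ ⟶ A₂} {a₁' : A₁ ⟶ A₃} {a₂' : A₂ ⟶ A₃}
    {b₁ : B₀ ⟶ B₁} {b₂ : B₀ ⟶ B₂} {b₁' : B₁ ⟶ B₃} {b₂' : B₂ ⟶ B₃}
    {d₁ : D₀ ⟶ D₁} {d₂ : D₀ ⟶ D₂} {d₁' : D₁ ⟶ D₃} {d₂' : D₂ ⟶ D₃}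
    {e₁ : E₀ ⟶ E₁} {e₂ : E₀ ⟶ E₂} {e₁' : E₁ ⟶ E₃} {e₂' : E₂ ⟶ E₃}
    (hA : IsPullback a₁ a₂ a₁' a₂') (hB : IsPullback b₁ b₂ b₁' b₂')
    (hD : IsPullback d₁ d₂ d₁' d₂')
    {f₀ : A₀ ⟶ B₀} {f₁ : A₁ ⟶ B₁} {f₂ : A₂ ⟶ B₂} {f₃ : A₃ ⟶ B₃}
    {g₀ : D₀ ⟶ B₀} {g₁ : D₁ ⟶ B₁} {g₂ : D₂ ⟶ B₂} {g₃ : D₃ ⟶ B₃}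
    {p₀ : E₀ ⟶ A₀} {p₁ : E₁ ⟶ A₁} {p₂ : E₂ ⟶ A₂} {p₃ : E₃ ⟶ A₃}
    {q₀ : E₀ ⟶ D₀} {q₁ : E₁ ⟶ D₁} {q₂ : E₂ ⟶ D₂} {q₃ : E₃ ⟶ D₃}
    (h₀ : IsPullback p₀ q₀ f₀ g₀) (h₁ : IsPullback p₁ q₁ f₁ g₁)
    (h₂ : IsPullback p₂ q₂ f₂ g₂) (h₃ : IsPullback p₃ q₃ f₃ g₃)
    (hf₁ : a₁ ≫ f₁ = f₀ ≫ b₁) (hf₂ : a₂ ≫ f₂ = f₀ ≫ b₂)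
    (hg₁ : d₁ ≫ g₁ = g₀ ≫ b₁) (hg₂ : d₂ ≫ g₂ = g₀ ≫ b₂)
    (hp₁ : e₁ ≫ p₁ = p₀ ≫ a₁) (hp₂ : e₂ ≫ p₂ = p₀ ≫ a₂)
    (hp₁' : e₁' ≫ p₃ = p₁ ≫ a₁') (hp₂' : e₂' ≫ p₃ = p₂ ≫ a₂')
    (hq₁ : e₁ ≫ q₁ = q₀ ≫ d₁) (hq₂ : e₂ ≫ q₂ = q₀ ≫ d₂)
    (hq₁' : e₁' ≫ q₃ = q₁ ≫ d₁') (hq₂' : e₂' ≫ q₃ = q₂ ≫ d₂') :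
    IsPullback e₁ e₂ e₁' e₂' := by
  refine IsPullback.mk' ?_ ?_ ?_
  · apply h₃.hom_ext
    · rw [Category.assoc, Category.assoc, hp₁', hp₂', reassoc_of% hp₁, reassoc_of% hp₂, hA.w]
    · rw [Category.assoc, Category.assoc, hq₁', hq₂', reassoc_of% hq₁, reassoc_of% hq₂, hD.w]
  · intro T φ φ' w₁ w₂
    apply h₀.hom_ext
    · apply hA.hom_ext
      · rw [Category.assoc, Category.assoc, ← hp₁, reassoc_of% w₁]
      · rw [Category.assoc, Category.assoc, ← hp₂, reassoc_of% w₂]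
    · apply hD.hom_ext
      · rw [Category.assoc, Category.assoc, ← hq₁, reassoc_of% w₁]
      · rw [Category.assoc, Category.assoc, ← hq₂, reassoc_of% w₂]
  · intro T x y w
    obtain ⟨s, hs₁, hs₂⟩ := hA.exists_lift (x ≫ p₁) (y ≫ p₂) (by
      rw [Category.assoc, Category.assoc, ← hp₁', ← hp₂', reassoc_of% w])
    obtain ⟨t, ht₁, ht₂⟩ := hD.exists_lift (x ≫ q₁) (y ≫ q₂) (by
      rw [Category.assoc, Category.assoc, ← hq₁', ← hq₂', reassoc_of% w])
    obtain ⟨l, hl₁, hl₂⟩ := h₀.exists_lift s t (by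
      apply hB.hom_ext
      · rw [Category.assoc, Category.assoc, ← hf₁, ← hg₁, reassoc_of% hs₁, reassoc_of% ht₁, h₁.w]
      · rw [Category.assoc, Category.assoc, ← hf₂, ← hg₂, reassoc_of% hs₂, reassoc_of% ht₂, h₂.w])
    refine ⟨l, ?_, ?_⟩
    · apply h₁.hom_ext
      · rw [Category.assoc, hp₁, reassoc_of% hl₁, hs₁]
      · rw [Category.assoc, hq₁, reassoc_of% hl₂, ht₁]
    · apply h₂.hom_ext
      · rw [Category.assoc, hp₂, reassoc_of% hl₁, hs₂]
      · rw [Category.assoc, hq₂, reassoc_of% hl₂, ht₂]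

/-- The comparison map between two pullback squares is an isomorphism if it is one at the three
corners of the cospans. -/
lemma isIso_of_isPullbacks {A₀ A₁ A₂ A₃ B₀ B₁ B₂ B₃ : C}
    {a₁ : A₀ ⟶ A₁} {a₂ : A₀ ⟶ A₂} {a₁' : A₁ ⟶ A₃} {a₂' : A₂ ⟶ A₃}
    {b₁ : B₀ ⟶ B₁} {b₂ : B₀ ⟶ B₂} {b₁' : B₁ ⟶ B₃} {b₂' : B₂ ⟶ B₃}
    (hA : IsPullback a₁ a₂ a₁' a₂') (hB : IsPullback b₁ b₂ b₁' b₂')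
    {f₀ : A₀ ⟶ B₀} {f₁ : A₁ ⟶ B₁} {f₂ : A₂ ⟶ B₂} {f₃ : A₃ ⟶ B₃}
    (hf₁ : a₁ ≫ f₁ = f₀ ≫ b₁) (hf₂ : a₂ ≫ f₂ = f₀ ≫ b₂)
    (hf₁' : a₁' ≫ f₃ = f₁ ≫ b₁') (hf₂' : a₂' ≫ f₃ = f₂ ≫ b₂')
    [IsIso f₁] [IsIso f₂] [IsIso f₃] : IsIso f₀ := by
  obtain ⟨l, hl₁, hl₂⟩ := hA.exists_lift (b₁ ≫ inv f₁) (b₂ ≫ inv f₂) (by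
    rw [← cancel_mono f₃]
    simp [hf₁', hf₂', hB.w])
  refine ⟨l, hA.hom_ext ?_ ?_, hB.hom_ext ?_ ?_⟩
  · rw [Category.assoc, hl₁, ← Category.assoc, ← hf₁]; simp
  · rw [Category.assoc, hl₂, ← Category.assoc, ← hf₂]; simp
  · rw [Category.assoc, ← hf₁, reassoc_of% hl₁]; simp
  · rw [Category.assoc, ← hf₂, reassoc_of% hl₂]; simp

/-- A commutative square which is isomorphic to a pullback square is a pullback square. -/
lemma isPullback_of_isIso_map {A₀ A₁ A₂ A₃ B₀ B₁ B₂ B₃ : C}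
    {a₁ : A₀ ⟶ A₁} {a₂ : A₀ ⟶ A₂} {a₁' : A₁ ⟶ A₃} {a₂' : A₂ ⟶ A₃}
    {b₁ : B₀ ⟶ B₁} {b₂ : B₀ ⟶ B₂} {b₁' : B₁ ⟶ B₃} {b₂' : B₂ ⟶ B₃}
    (hA : IsPullback a₁ a₂ a₁' a₂')
    (f₀ : A₀ ⟶ B₀) (f₁ : A₁ ⟶ B₁) (f₂ : A₂ ⟶ B₂) (f₃ : A₃ ⟶ B₃)
    [IsIso f₀] [IsIso f₁] [IsIso f₂] [IsIso f₃]
    (hf₁ : a₁ ≫ f₁ = f₀ ≫ b₁) (hf₂ : a₂ ≫ f₂ = f₀ ≫ b₂)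
    (hf₁' : a₁' ≫ f₃ = f₁ ≫ b₁') (hf₂' : a₂' ≫ f₃ = f₂ ≫ b₂') : IsPullback b₁ b₂ b₁' b₂' :=
  hA.of_iso (asIso f₀) (asIso f₁) (asIso f₂) (asIso f₃) hf₁ hf₂ hf₁' hf₂'

end Squares

/-! ### Pullbacks of categories over a thin category -/

section CatPullback

/-- The strict pullback of `F : C ⟶ E` and `G : D ⟶ E`, when `E` has at most one morphism between
any two objects. In this case it is a full subcategory of `C × D`. -/
def thinPullback {C D E : Cat.{u, u}} (F : C ⟶ E) (G : D ⟶ E) : Cat.{u, u} :=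
  Cat.of (ObjectProperty.FullSubcategory
    (fun x : C × D => F.toFunctor.obj x.1 = G.toFunctor.obj x.2))

variable {C D E : Cat.{u, u}} (F : C ⟶ E) (G : D ⟶ E)

/-- The first projection of `thinPullback F G`. -/
def thinPullbackFst : thinPullback F G ⟶ C :=
  (ObjectProperty.ι _ ⋙ CategoryTheory.Prod.fst C D).toCatHom

/-- The second projection of `thinPullback F G`. -/
def thinPullbackSnd : thinPullback F G ⟶ D :=
  (ObjectProperty.ι _ ⋙ CategoryTheory.Prod.snd C D).toCatHom

lemma isPullback_thinPullback [Quiver.IsThin E] :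
    IsPullback (thinPullbackFst F G) (thinPullbackSnd F G) F G := by
  refine IsPullback.mk' ?_ ?_ ?_
  · apply Cat.Hom.ext
    exact CategoryTheory.Functor.ext (fun x => x.property) (fun x y f => Subsingleton.elim _ _)
  · intro T φ φ' h₁ h₂
    apply Cat.Hom.ext
    have h₁' : φ.toFunctor ⋙ (thinPullbackFst F G).toFunctor =
      φ'.toFunctor ⋙ (thinPullbackFst F G).toFunctor := congr(($h₁).toFunctor)
    have h₂' : φ.toFunctor ⋙ (thinPullbackSnd F G).toFunctor =
      φ'.toFunctor ⋙ (thinPullbackSnd F G).toFunctor := congr(($h₂).toFunctor)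
    -- Functors to the full subcategory are determined by their composites with the inclusion.
    have key : φ.toFunctor ⋙ ObjectProperty.ι _ = φ'.toFunctor ⋙ ObjectProperty.ι _ := by
      have e := congrArg₂ (fun a b => CategoryTheory.Functor.prod' a b) h₁' h₂'
      exact e
    have lift_eq (ψ : T ⟶ thinPullback F G) (H : T ⥤ C × D)
        (hH : ψ.toFunctor ⋙ ObjectProperty.ι _ = H) :
        ψ.toFunctor = ObjectProperty.lift _ H
          (fun x => hH ▸ (ψ.toFunctor.obj x).property) := by
      subst hH
      rfl
    exact (lift_eq φ _ key).trans (lift_eq φ' _ rfl).symm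
  · intro T a b h
    have h' : a.toFunctor ⋙ F.toFunctor = b.toFunctor ⋙ G.toFunctor := congr(($h).toFunctor)
    exact ⟨(ObjectProperty.lift _ (Functor.prod' a.toFunctor b.toFunctor)
      (fun x => CategoryTheory.Functor.congr_obj h' x)).toCatHom, rfl, rfl⟩

variable {F G} {P : Cat.{u, u}} {p : P ⟶ C} {q : P ⟶ D}

/-- The pullback over a thin category is a full subcategory of the product. -/
def fullyFaithfulProdOfIsPullback [Quiver.IsThin E] (h : IsPullback p q F G) :
    (Functor.prod' p.toFunctor q.toFunctor).FullyFaithful := by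
  let e := h.isoIsPullback _ _ (isPullback_thinPullback F G)
  have he : Functor.prod' p.toFunctor q.toFunctor =
      e.hom.toFunctor ⋙ (ObjectProperty.ι _ : thinPullback F G ⥤ C × D) := by
    have e₁ := h.isoIsPullback_hom_fst _ _ (isPullback_thinPullback F G)
    have e₂ := h.isoIsPullback_hom_snd _ _ (isPullback_thinPullback F G)
    exact congrArg₂ (fun a b => CategoryTheory.Functor.prod' (Cat.Hom.toFunctor a)
      (Cat.Hom.toFunctor b)) e₁.symm e₂.symm
  rw [he]
  exact (Cat.equivOfIso e).fullyFaithfulFunctor.comp (ObjectProperty.fullyFaithfulι _)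

lemma exists_obj_of_isPullback (h : IsPullback p q F G) (c : C) (d : D)
    (w : F.toFunctor.obj c = G.toFunctor.obj d) :
    ∃ x : P, p.toFunctor.obj x = c ∧ q.toFunctor.obj x = d :=
  Types.exists_of_isPullback (h.map Cat.objects) c d w

/-- Isomorphism classes of objects preserve pullbacks over a discrete category. -/
lemma isPullback_isomorphismClasses [hE : CategoryTheory.IsDiscrete E] (h : IsPullback p q F G) :
    IsPullback (isomorphismClasses.map p) (isomorphismClasses.map q)
      (isomorphismClasses.map F) (isomorphismClasses.map G) := by
  rw [Types.isPullback_iff]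
  refine ⟨by rw [← Functor.map_comp, h.w, Functor.map_comp], ?_, ?_⟩
  · rintro ⟨x⟩ ⟨y⟩ ⟨h₁, h₂⟩
    obtain ⟨e₁⟩ : IsIsomorphic _ _ := Quotient.exact h₁
    obtain ⟨e₂⟩ : IsIsomorphic _ _ := Quotient.exact h₂
    exact Quotient.sound ⟨(fullyFaithfulProdOfIsPullback h).preimageIso (e₁.prod e₂)⟩
  · rintro ⟨x⟩ ⟨y⟩ h₁
    obtain ⟨e₁⟩ : IsIsomorphic _ _ := Quotient.exact h₁
    obtain ⟨z, hz₁, hz₂⟩ := exists_obj_of_isPullback h x y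
      (CategoryTheory.IsDiscrete.eq_of_hom e₁.hom)
    exact ⟨Quotient.mk _ z, congrArg (Quotient.mk _) hz₁, congrArg (Quotient.mk _) hz₂⟩

lemma isEquivRel_of_isPullback [Quiver.IsThin E] (h : IsPullback p q F G) (hC : IsEquivRel C)
    (hD : IsEquivRel D) : IsEquivRel P := by
  have H := fullyFaithfulProdOfIsPullback h
  have := hC.1
  have := hD.1
  have := hC.2
  have := hD.2
  refine ⟨fun x y => ⟨fun f g => H.map_injective ?_⟩, ⟨fun f => ?_⟩⟩
  · exact Prod.ext (Subsingleton.elim _ _) (Subsingleton.elim _ _)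
  · have : IsIso ((Functor.prod' p.toFunctor q.toFunctor).map f) := by
      rw [isIso_prod_iff]
      exact ⟨IsGroupoid.all_isIso _, IsGroupoid.all_isIso _⟩
    exact H.isIso_of_isIso_map f

/-- A pullback of equivalences of categories over discrete categories is an equivalence. -/
lemma isCatEquiv_of_isPullbacks {C' D' E' P' : Cat.{u, u}} {F' : C' ⟶ E'} {G' : D' ⟶ E'}
    {p' : P' ⟶ C'} {q' : P' ⟶ D'} [CategoryTheory.IsDiscrete E] [CategoryTheory.IsDiscrete E']
    (h : IsPullback p q F G) (h' : IsPullback p' q' F' G')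
    {a : P ⟶ P'} {c : C ⟶ C'} {d : D ⟶ D'} {e : E ⟶ E'} [IsIso e]
    (hp : p ≫ c = a ≫ p') (hq : q ≫ d = a ≫ q') (hF : F ≫ e = c ≫ F') (hG : G ≫ e = d ≫ G')
    (hc : IsCatEquiv c) (hd : IsCatEquiv d) : IsCatEquiv a := by
  have : c.toFunctor.IsEquivalence := hc
  have : d.toFunctor.IsEquivalence := hd
  have H := fullyFaithfulProdOfIsPullback h
  have H' := fullyFaithfulProdOfIsPullback h'
  have := H'.faithful
  have hac : a.toFunctor ⋙ Functor.prod' p'.toFunctor q'.toFunctor =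
      Functor.prod' p.toFunctor q.toFunctor ⋙ c.toFunctor.prod d.toFunctor := by
    have e₁ : p.toFunctor ⋙ c.toFunctor = a.toFunctor ⋙ p'.toFunctor := congr(($hp).toFunctor)
    have e₂ : q.toFunctor ⋙ d.toFunctor = a.toFunctor ⋙ q'.toFunctor := congr(($hq).toFunctor)
    exact (congrArg₂ (fun a b => CategoryTheory.Functor.prod' a b) e₁ e₂).symm
  have hff : (a.toFunctor ⋙ Functor.prod' p'.toFunctor q'.toFunctor).FullyFaithful := by
    rw [hac]
    have := H.full
    have := H.faithful
    have : (c.toFunctor.prod d.toFunctor).Full :=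
      ⟨fun f => ⟨(c.toFunctor.preimage f.1, d.toFunctor.preimage f.2), by simp⟩⟩
    have : (c.toFunctor.prod d.toFunctor).Faithful :=
      ⟨fun {_ _ f g} w => Prod.ext (c.toFunctor.map_injective congr(($w).1))
        (d.toFunctor.map_injective congr(($w).2))⟩
    exact Functor.FullyFaithful.ofFullyFaithful _
  have ha := Functor.FullyFaithful.ofCompFaithful hff
  have : a.toFunctor.Full := ha.full
  have : a.toFunctor.Faithful := ha.faithful
  have : a.toFunctor.EssSurj := ⟨fun z => by
    let x := c.toFunctor.objPreimage (p'.toFunctor.obj z)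
    let ex : c.toFunctor.obj x ≅ p'.toFunctor.obj z := c.toFunctor.objObjPreimageIso _
    let y := d.toFunctor.objPreimage (q'.toFunctor.obj z)
    let ey : d.toFunctor.obj y ≅ q'.toFunctor.obj z := d.toFunctor.objObjPreimageIso _
    -- Isomorphic objects of the discrete category `E'` are equal, and `e` is injective on objects,
    -- so that preimages of the components of `z` match on the nose.
    have w : F.toFunctor.obj x = G.toFunctor.obj y := by
      have hinj : Function.Injective e.toFunctor.obj := by
        have : IsIso (Cat.objects.map e) := inferInstance
        exact ((isIso_iff_bijective _).1 this).1
      apply hinj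
      have e₁ : e.toFunctor.obj (F.toFunctor.obj x) = F'.toFunctor.obj (c.toFunctor.obj x) :=
        CategoryTheory.Functor.congr_obj congr(($hF).toFunctor) x
      have e₂ : e.toFunctor.obj (G.toFunctor.obj y) = G'.toFunctor.obj (d.toFunctor.obj y) :=
        CategoryTheory.Functor.congr_obj congr(($hG).toFunctor) y
      have e₃ : F'.toFunctor.obj (p'.toFunctor.obj z) = G'.toFunctor.obj (q'.toFunctor.obj z) :=
        CategoryTheory.Functor.congr_obj congr(($(h'.w)).toFunctor) z
      rw [e₁, e₂, CategoryTheory.IsDiscrete.eq_of_hom (F'.toFunctor.map ex.hom), e₃,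
        CategoryTheory.IsDiscrete.eq_of_hom (G'.toFunctor.map ey.hom)]
    obtain ⟨t, ht₁, ht₂⟩ := exists_obj_of_isPullback h x y w
    refine ⟨t, ⟨H'.preimageIso ?_⟩⟩
    refine (eqToIso (CategoryTheory.Functor.congr_obj hac t)) ≪≫ Iso.prod ?_ ?_
    · exact c.toFunctor.mapIso (eqToIso ht₁) ≪≫ ex
    · exact d.toFunctor.mapIso (eqToIso ht₂) ≪≫ ey⟩
  exact { }

/-- The base change of a fully faithful functor to a thin category which is surjective on objects is
an equivalence. -/
lemma isCatEquiv_fst_of_isPullback [Quiver.IsThin E] (h : IsPullback p q F G)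
    (hG : G.toFunctor.FullyFaithful) (hG' : Function.Surjective G.toFunctor.obj) :
    IsCatEquiv p := by
  have H := fullyFaithfulProdOfIsPullback h
  have w (x : P) : F.toFunctor.obj (p.toFunctor.obj x) = G.toFunctor.obj (q.toFunctor.obj x) :=
    CategoryTheory.Functor.congr_obj congr(($(h.w)).toFunctor) x
  have : p.toFunctor.Faithful := ⟨fun {x y f g} hfg => H.map_injective
    (Prod.ext hfg (hG.map_injective (Subsingleton.elim _ _)))⟩
  have : p.toFunctor.Full := ⟨fun {x y} f => by
    let k : q.toFunctor.obj x ⟶ q.toFunctor.obj y :=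
      hG.preimage (eqToHom (w x).symm ≫ F.toFunctor.map f ≫ eqToHom (w y))
    let fk : (Functor.prod' p.toFunctor q.toFunctor).obj x ⟶
      (Functor.prod' p.toFunctor q.toFunctor).obj y := (f, k)
    exact ⟨H.preimage fk, congr(($(H.map_preimage fk)).1)⟩⟩
  have : p.toFunctor.EssSurj := ⟨fun c => by
    obtain ⟨d, hd⟩ := hG' (F.toFunctor.obj c)
    obtain ⟨x, hx, -⟩ := exists_obj_of_isPullback h c d hd.symm
    exact ⟨x, ⟨eqToIso hx⟩⟩⟩
  exact { }

end CatPullback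

/-! ### Levelwise arguments -/

lemma isPullback_iff_app {D : Type*} [Category* D] [HasPullbacks D] (P X Y Z : SimplicialObject D)
    (p : P ⟶ X) (q : P ⟶ Y) (f : X ⟶ Z) (g : Y ⟶ Z) : IsPullback p q f g ↔
      ∀ k : ℕ, IsPullback (p.app (op (SimplexCategory.mk k))) (q.app (op (SimplexCategory.mk k)))
        (f.app (op (SimplexCategory.mk k))) (g.app (op (SimplexCategory.mk k))) :=
  ⟨fun h k => h.app (op (SimplexCategory.mk k)),
    fun h => IsPullback.of_forall_isPullback_app fun k => h k.unop.len⟩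

instance instHasLimitsMSSet : ∀ m : ℕ, HasLimits (MSSet.{u} m)
  | 0 => inferInstanceAs (HasLimits (Type u))
  | m + 1 =>
    have := instHasLimitsMSSet m
    inferInstanceAs (HasLimits (SimplexCategoryᵒᵖ ⥤ MSSet.{u} m))

/-- An `(m + 1)`-fold simplicial set as a simplicial `m`-fold simplicial set. -/
def toSimpSet (m : ℕ) : MSSet.{u} (m + 1) ⥤ SimplicialObject (MSSet.{u} m) := 𝟭 _

/-- `S ↦ S_k`, evaluation of the first simplicial direction of a multi-simplicial set at `[k]`. -/
def levSet (m k : ℕ) : MSSet.{u} (m + 1) ⥤ MSSet.{u} m :=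
  toSimpSet m ⋙ (evaluation _ _).obj (op (SimplexCategory.mk k))

lemma isPullback_iff_lev {m : ℕ} {P X Y Z : MSCat.{u} (m + 1)} {p : P ⟶ X} {q : P ⟶ Y} {f : X ⟶ Z}
    {g : Y ⟶ Z} : IsPullback p q f g ↔ ∀ k, IsPullback ((lev m k).map p) ((lev m k).map q)
      ((lev m k).map f) ((lev m k).map g) :=
  isPullback_iff_app (D := MSCat.{u} m) ((toSimp m).obj P) ((toSimp m).obj X) ((toSimp m).obj Y)
    ((toSimp m).obj Z) ((toSimp m).map p) ((toSimp m).map q) ((toSimp m).map f) ((toSimp m).map g)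

lemma isPullback_iff_levSet {m : ℕ} {P X Y Z : MSSet.{u} (m + 1)} {p : P ⟶ X} {q : P ⟶ Y}
    {f : X ⟶ Z} {g : Y ⟶ Z} : IsPullback p q f g ↔ ∀ k, IsPullback ((levSet m k).map p)
      ((levSet m k).map q) ((levSet m k).map f) ((levSet m k).map g) :=
  isPullback_iff_app (D := MSSet.{u} m) ((toSimpSet m).obj P) ((toSimpSet m).obj X)
    ((toSimpSet m).obj Y) ((toSimpSet m).obj Z) ((toSimpSet m).map p) ((toSimpSet m).map q)
    ((toSimpSet m).map f) ((toSimpSet m).map g)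

lemma isIso_iff_lev {m : ℕ} {X Y : MSCat.{u} (m + 1)} (f : X ⟶ Y) :
    IsIso f ↔ ∀ k, IsIso ((lev m k).map f) :=
  ⟨fun _ _ => inferInstance, fun h =>
    (NatTrans.isIso_iff_isIso_app (D := MSCat.{u} m) f).2 fun k => h k.unop.len⟩

lemma isIso_iff_levSet {m : ℕ} {X Y : MSSet.{u} (m + 1)} (f : X ⟶ Y) :
    IsIso f ↔ ∀ k, IsIso ((levSet m k).map f) :=
  ⟨fun _ _ => inferInstance, fun h =>
    (NatTrans.isIso_iff_isIso_app (D := MSSet.{u} m) f).2 fun k => h k.unop.len⟩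

/-! ### The truncation and pullbacks over levelwise discrete objects -/

/-- The only morphisms of the category `C` are the identities. -/
def IsDiscCat (C : Cat.{u, u}) : Prop := CategoryTheory.IsDiscrete C

/-- All the categories `X_s` are discrete. -/
def LevDisc : ∀ m : ℕ, MSCat.{u} m → Prop
  | 0, C => IsDiscCat C
  | m + 1, X => ∀ k : ℕ, LevDisc m ((lev m k).obj X)

/-- The functor `p` preserves pullbacks over discrete categories, levelwise. -/
lemma isPullback_pBar : ∀ {m : ℕ} {P X Y Z : MSCat.{u} m} {p : P ⟶ X} {q : P ⟶ Y} {f : X ⟶ Z}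
    {g : Y ⟶ Z}, LevDisc m Z → IsPullback p q f g →
      IsPullback ((pBar m).map p) ((pBar m).map q) ((pBar m).map f) ((pBar m).map g)
  | 0, _, _, _, _, _, _, _, _, hZ, h => isPullback_isomorphismClasses (hE := hZ) h
  | _ + 1, _, _, _, _, _, _, _, _, hZ, h =>
    isPullback_iff_levSet.2 fun k => isPullback_pBar (hZ k) (isPullback_iff_lev.1 h k)

/-- A reflector preserves pullbacks of diagrams which lie in the reflective subcategory up to
isomorphism, and their pullbacks lie in it as well. -/
lemma isPullback_of_reflective {C D : Type*} [Category* C] [Category* D] [HasPullbacks D]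
    {L : C ⥤ D} {R : D ⥤ C} (adj : L ⊣ R) [R.Full] [R.Faithful] {P X Y Z : C} {p : P ⟶ X}
    {q : P ⟶ Y} {f : X ⟶ Z} {g : Y ⟶ Z} (h : IsPullback p q f g) (hX : IsIso (adj.unit.app X))
    (hY : IsIso (adj.unit.app Y)) (hZ : IsIso (adj.unit.app Z)) :
    IsIso (adj.unit.app P) ∧ IsPullback (L.map p) (L.map q) (L.map f) (L.map g) := by
  have : R.IsRightAdjoint := adj.isRightAdjoint
  have hQ := (IsPullback.of_hasPullback (L.map f) (L.map g)).map R
  have hQ' : IsPullback (R.map (pullback.fst (L.map f) (L.map g)) ≫ inv (adj.unit.app X))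
      (R.map (pullback.snd (L.map f) (L.map g)) ≫ inv (adj.unit.app Y)) f g :=
    hQ.of_iso (Iso.refl _) (asIso (adj.unit.app X)).symm (asIso (adj.unit.app Y)).symm
      (asIso (adj.unit.app Z)).symm (by simp) (by simp)
      (by simp) (by simp)
  have hP : IsIso (adj.unit.app P) :=
    adj.isIso_unit_app_of_iso (h.isoIsPullback _ _ hQ')
  refine ⟨hP, ?_⟩
  have hRL : IsPullback (R.map (L.map p)) (R.map (L.map q)) (R.map (L.map f)) (R.map (L.map g)) :=
    isPullback_of_isIso_map h (adj.unit.app P) (adj.unit.app X) (adj.unit.app Y) (adj.unit.app Z)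
      (by simp) (by simp) (by simp) (by simp)
  exact hRL.of_map_of_faithful R

lemma isPullback_unnerve : ∀ {m : ℕ} {P X Y Z : MSSet.{u} (m + 1)} {p : P ⟶ X} {q : P ⟶ Y}
    {f : X ⟶ Z} {g : Y ⟶ Z}, IsPullback p q f g → IsIso ((nerveUnit m).app X) →
      IsIso ((nerveUnit m).app Y) → IsIso ((nerveUnit m).app Z) → IsIso ((nerveUnit m).app P) ∧
        IsPullback ((unnerve m).map p) ((unnerve m).map q) ((unnerve m).map f) ((unnerve m).map g)
  | 0, _, _, _, _, _, _, _, _, h, hX, hY, hZ =>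
    isPullback_of_reflective nerveAdjunction.{u} h hX hY hZ
  | m + 1, _, _, _, _, _, _, _, _, h, hX, hY, hZ => by
    have key (k : ℕ) := isPullback_unnerve (isPullback_iff_levSet.1 h k)
      ((isIso_iff_levSet _).1 hX k) ((isIso_iff_levSet _).1 hY k) ((isIso_iff_levSet _).1 hZ k)
    exact ⟨(isIso_iff_levSet _).2 fun k => (key k).1,
      isPullback_iff_lev.2 fun k => (key k).2⟩

/-- The truncation preserves pullbacks over levelwise discrete objects. Without discreteness this
fails already for `p : Cat ⥤ Set`. -/
lemma isPullback_trunc {m : ℕ} {P X Y Z : MSCat.{u} (m + 1)} {p : P ⟶ X} {q : P ⟶ Y} {f : X ⟶ Z}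
    {g : Y ⟶ Z} (h : IsPullback p q f g) (hZ' : LevDisc (m + 1) Z) (hX : HasTruncation m X)
    (hY : HasTruncation m Y) (hZ : HasTruncation m Z) :
    IsPullback ((trunc m).map p) ((trunc m).map q) ((trunc m).map f) ((trunc m).map g) :=
  (isPullback_unnerve (isPullback_pBar hZ' h) hX hY hZ).2

lemma hasTruncation_of_isPullback {m : ℕ} {P X Y Z : MSCat.{u} (m + 1)} {p : P ⟶ X} {q : P ⟶ Y}
    {f : X ⟶ Z} {g : Y ⟶ Z} (h : IsPullback p q f g) (hZ' : LevDisc (m + 1) Z)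
    (hX : HasTruncation m X) (hY : HasTruncation m Y) (hZ : HasTruncation m Z) :
    HasTruncation m P :=
  (isPullback_unnerve (isPullback_pBar hZ' h) hX hY hZ).1

lemma hasTruncation_of_iso {m : ℕ} {X Y : MSCat.{u} (m + 1)} (e : X ≅ Y) (h : HasTruncation m X) :
    HasTruncation m Y := by
  have : IsIso ((truncUnit m).app X) := h
  exact (NatTrans.isIso_app_iff_of_iso (truncUnit m) e).1 h

/-! ### Discrete inclusions -/

/-- `p d A ≅ A` for a set `A`. -/
def typeToCatIsomorphismClasses : typeToCat.{u} ⋙ isomorphismClasses.{u, u} ≅ 𝟭 (Type u) :=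
  NatIso.ofComponents (fun A => Equiv.toIso
    { toFun := Quotient.lift Discrete.as (fun _ _ ⟨e⟩ => Discrete.eq_of_hom e.hom)
      invFun := fun a => Quotient.mk (isIsomorphicSetoid (Discrete A)) (Discrete.mk a)
      left_inv := by rintro ⟨x⟩; rfl
      right_inv := fun _ => rfl }) (by
    intro A B f
    ext ⟨x⟩
    rfl)

/-- `p d S ≅ S` levelwise. -/
def dBarCompPBar : ∀ m : ℕ, dBar.{u} m ⋙ pBar.{u} m ≅ 𝟭 (MSSet.{u} m)
  | 0 => typeToCatIsomorphismClasses
  | m + 1 => (Functor.whiskeringRight SimplexCategoryᵒᵖ (MSSet.{u} m) (MSSet.{u} m)).mapIso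
      (dBarCompPBar m)

/-- The multinerve is fully faithful, so that `unnerve` is a retraction of it. -/
def multinerveCompUnnerve : ∀ m : ℕ, multinerve.{u} m ⋙ unnerve.{u} m ≅ 𝟭 (MSCat.{u} m)
  | 0 => nerveFunctorCompHoFunctorIso
  | m + 1 => (Functor.whiskeringRight SimplexCategoryᵒᵖ (MSCat.{u} m) (MSCat.{u} m)).mapIso
      (multinerveCompUnnerve m)

lemma isIso_nerveAdjunction_unit_nerve (W : Cat.{u, u}) :
    IsIso (nerveAdjunction.unit.app (nerveFunctor.obj W)) := inferInstance

lemma isIso_nerveUnit_multinerve : ∀ {m : ℕ} (W : MSCat.{u} m),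
    IsIso ((nerveUnit m).app ((multinerve m).obj W))
  | 0, W => isIso_nerveAdjunction_unit_nerve W
  | m + 1, W => (isIso_iff_levSet _).2 fun k => isIso_nerveUnit_multinerve ((lev m k).obj W)

/-- `p⁽ⁿ⁾ d⁽ⁿ⁾ W ≅ W`. -/
def dInclCompTrunc (m : ℕ) : dIncl.{u} m ⋙ trunc.{u} m ≅ 𝟭 (MSCat.{u} m) :=
  Functor.isoWhiskerLeft (multinerve m) (Functor.isoWhiskerRight (dBarCompPBar (m + 1)) (unnerve m))
    ≪≫ multinerveCompUnnerve m

lemma hasTruncation_dIncl {m : ℕ} (W : MSCat.{u} m) : HasTruncation m ((dIncl m).obj W) :=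
  (NatTrans.isIso_app_iff_of_iso (nerveUnit m)
    ((dBarCompPBar (m + 1)).app ((multinerve m).obj W))).2 (isIso_nerveUnit_multinerve W)

lemma isDiscCat_typeToCat (A : Type u) : IsDiscCat (typeToCat.obj A) :=
  inferInstanceAs (CategoryTheory.IsDiscrete (Discrete A))

lemma levDisc_dBar : ∀ {m : ℕ} (S : MSSet.{u} m), LevDisc m ((dBar m).obj S)
  | 0, S => isDiscCat_typeToCat S
  | m + 1, S => fun k => levDisc_dBar ((levSet m k).obj S)

lemma isDiscCat_of_iso {C D : Cat.{u, u}} (e : C ≅ D) (h : IsDiscCat C) : IsDiscCat D where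
  subsingleton _ _ := ⟨fun _ _ =>
    (Cat.equivOfIso e).inverse.map_injective ((h.subsingleton _ _).elim _ _)⟩
  eq_of_hom f :=
    ((isIso_iff_bijective (Cat.objects.map e.inv)).1 inferInstance).1
      (h.eq_of_hom (e.inv.toFunctor.map f))

lemma levDisc_of_iso : ∀ {m : ℕ} {X Y : MSCat.{u} m}, (X ≅ Y) → LevDisc m X → LevDisc m Y
  | 0, _, _, e, h => isDiscCat_of_iso e h
  | m + 1, _, _, e, h => fun k => levDisc_of_iso ((lev m k).mapIso e) (h k)

/-- The multinerve is fully faithful. -/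
def multinerveFullyFaithful : ∀ m : ℕ, (multinerve.{u} m).FullyFaithful
  | 0 => nerveFunctor.fullyfaithful
  | m + 1 => (multinerveFullyFaithful m).whiskeringRight SimplexCategoryᵒᵖ

/-- The levelwise discrete category functor is fully faithful. -/
def dBarFullyFaithful : ∀ m : ℕ, (dBar.{u} m).FullyFaithful
  | 0 => Functor.FullyFaithful.ofFullyFaithful typeToCat.{u}
  | m + 1 => (dBarFullyFaithful m).whiskeringRight SimplexCategoryᵒᵖ

/-- The inclusion of sets as discrete `n`-fold structures is fully faithful. -/
def discFullyFaithful : ∀ m : ℕ, (disc.{u} m).FullyFaithful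
  | 0 => Functor.FullyFaithful.ofFullyFaithful typeToCat.{u}
  | m + 1 => (discFullyFaithful m).comp ((multinerveFullyFaithful m).comp (dBarFullyFaithful _))

instance (m : ℕ) : (disc.{u} m).Full := (discFullyFaithful m).full
instance (m : ℕ) : (disc.{u} m).Faithful := (discFullyFaithful m).faithful

lemma isRightAdjoint_whiskeringRight {J C D : Type*} [Category* J] [Category* C] [Category* D]
    (G : C ⥤ D) [G.IsRightAdjoint] : ((Functor.whiskeringRight J C D).obj G).IsRightAdjoint :=
  ((Adjunction.ofIsRightAdjoint G).whiskerRight J).isRightAdjoint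

instance isRightAdjoint_multinerve : ∀ m : ℕ, (multinerve.{u} m).IsRightAdjoint
  | 0 => nerveAdjunction.{u}.isRightAdjoint
  | m + 1 =>
    have := isRightAdjoint_multinerve m
    isRightAdjoint_whiskeringRight (J := SimplexCategoryᵒᵖ) (multinerve m)

instance isRightAdjoint_dBar : ∀ m : ℕ, (dBar.{u} m).IsRightAdjoint
  | 0 => Cat.connectedComponentsTypeToCatAdj.{u}.isRightAdjoint
  | m + 1 =>
    have := isRightAdjoint_dBar m
    isRightAdjoint_whiskeringRight (J := SimplexCategoryᵒᵖ) (dBar m)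

instance isRightAdjoint_disc : ∀ m : ℕ, (disc.{u} m).IsRightAdjoint
  | 0 => Cat.connectedComponentsTypeToCatAdj.{u}.isRightAdjoint
  | m + 1 =>
    have := isRightAdjoint_disc m
    inferInstanceAs (disc m ⋙ multinerve m ⋙ dBar (m + 1)).IsRightAdjoint

/-- The constant simplicial object functor, into `MSCat (m + 1)`. -/
def constMSCat (m : ℕ) : MSCat.{u} m ⥤ MSCat.{u} (m + 1) := SimplicialObject.const (MSCat.{u} m)

/-- The nerve of a discrete category is constant. -/
def typeToCatCompNerve : typeToCat.{u} ⋙ nerveFunctor.{u, u} ≅ SimplicialObject.const (Type u) :=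
  NatIso.ofComponents (fun A => NatIso.ofComponents (fun k => Equiv.toIso
    { toFun := fun s : ComposableArrows (Discrete A) _ => (s.obj 0).as
      invFun := fun a => (CategoryTheory.Functor.const _).obj (Discrete.mk a)
      left_inv := fun s => by
        refine CategoryTheory.Functor.ext (fun i => ?_) (fun _ _ _ =>
          Subsingleton.elim (α := (_ : Discrete A) ⟶ _) _ _)
        exact Discrete.ext (Discrete.eq_of_hom (s.map' 0 i))
      right_inv := fun _ => rfl }) (by
    intro k l f
    ext s
    exact (Discrete.eq_of_hom (s.map (homOfLE (Fin.zero_le _)))).symm)) (by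
    intro A B f
    rfl)

/-- Applying a functor levelwise to constant simplicial objects. -/
def constCompWhiskering {C D : Type*} [Category* C] [Category* D] (G : C ⥤ D) :
    SimplicialObject.const C ⋙ (SimplicialObject.whiskering C D).obj G ≅
      G ⋙ SimplicialObject.const D :=
  NatIso.ofComponents (fun X => NatIso.ofComponents (fun _ => Iso.refl _) (by
    intro _ _ _
    simp [SimplicialObject.whiskering, SimplicialObject.const])) (by
    intro _ _ _
    ext
    simp [SimplicialObject.whiskering, SimplicialObject.const])

/-- A discrete object is constant in the first simplicial direction. -/
def discSuccIso : ∀ m : ℕ, disc.{u} (m + 1) ≅ disc.{u} m ⋙ constMSCat.{u} m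
  | 0 => Functor.isoWhiskerRight typeToCatCompNerve
      ((SimplicialObject.whiskering (Type u) Cat.{u, u}).obj typeToCat) ≪≫
        constCompWhiskering typeToCat
  | m + 1 => Functor.isoWhiskerRight (discSuccIso m) (dIncl (m + 1)) ≪≫
      Functor.isoWhiskerLeft (disc m) (constCompWhiskering (dIncl m))

/-- Simplicial sets as objects of `MSCat (m + 1)` which are discrete in all directions but the
first. -/
def discLev (m : ℕ) : SSet.{u} ⥤ MSCat.{u} (m + 1) :=
  (SimplicialObject.whiskering (Type u) (MSCat.{u} m)).obj (disc m)

/-- Categories as objects of `MSCat m` which are discrete in all directions but the first. For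
`m = 0` this is the identity, and for `m > 0` the first direction is simplicial, and the nerve is
taken. -/
def catIncl : ∀ m : ℕ, Cat.{u, u} ⥤ MSCat.{u} m
  | 0 => 𝟭 Cat.{u, u}
  | m + 1 => nerveFunctor.{u, u} ⋙ discLev m

/-- `X` is isomorphic to the discrete object on a set. -/
def IsDiscr (m : ℕ) (X : MSCat.{u} m) : Prop := ∃ A : Type u, Nonempty (X ≅ (disc m).obj A)

/-- `X` is isomorphic to a category, regarded as an `n`-fold structure which is discrete in all
directions but the first. -/
def IsCatLike (m : ℕ) (X : MSCat.{u} m) : Prop :=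
  ∃ C : Cat.{u, u}, Nonempty (X ≅ (catIncl m).obj C)

lemma IsDiscr.of_iso {m : ℕ} {X Y : MSCat.{u} m} (h : IsDiscr m X) (e : X ≅ Y) : IsDiscr m Y :=
  let ⟨A, ⟨i⟩⟩ := h
  ⟨A, ⟨e.symm ≪≫ i⟩⟩

lemma isDiscr_disc (m : ℕ) (A : Type u) : IsDiscr m ((disc m).obj A) := ⟨A, ⟨Iso.refl _⟩⟩

/-- The truncation of a category with discrete directions is the same category. -/
def catInclCompTrunc : ∀ m : ℕ, catIncl.{u} (m + 1) ⋙ trunc.{u} m ≅ catIncl.{u} m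
  | 0 => dInclCompTrunc 0
  | m + 1 => Functor.isoWhiskerLeft nerveFunctor
      ((Functor.whiskeringRight SimplexCategoryᵒᵖ (Type u) (MSCat.{u} m)).mapIso
        (Functor.isoWhiskerLeft (disc m) (dInclCompTrunc m)))

/-- The truncation of a discrete object is the discrete object on the same set. -/
def discCompTrunc (m : ℕ) : disc.{u} (m + 1) ⋙ trunc.{u} m ≅ disc.{u} m :=
  Functor.isoWhiskerLeft (disc m) (dInclCompTrunc m)

lemma hasTruncation_disc (m : ℕ) (A : Type u) : HasTruncation m ((disc (m + 1)).obj A) :=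
  hasTruncation_dIncl _

lemma hasTruncation_catIncl : ∀ (m : ℕ) (C : Cat.{u, u}),
    HasTruncation m ((catIncl (m + 1)).obj C)
  | 0, C => hasTruncation_dIncl (m := 0) C
  | m + 1, C => (isIso_iff_levSet _).2 fun k =>
      hasTruncation_disc m ((nerve C).obj (op (SimplexCategory.mk k)))

lemma levDisc_disc : ∀ (m : ℕ) (A : Type u), LevDisc m ((disc m).obj A)
  | 0, A => isDiscCat_typeToCat A
  | _ + 1, _ => levDisc_dBar _

lemma levDisc_discLev (m : ℕ) (S : SSet.{u}) : LevDisc (m + 1) ((discLev m).obj S) :=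
  fun k => levDisc_disc m (S.obj (op (SimplexCategory.mk k)))

lemma IsDiscr.levDisc {m : ℕ} {X : MSCat.{u} m} (h : IsDiscr m X) : LevDisc m X :=
  let ⟨_, ⟨e⟩⟩ := h
  levDisc_of_iso e.symm (levDisc_disc m _)

lemma IsDiscr.hasTruncation {m : ℕ} {X : MSCat.{u} (m + 1)} (h : IsDiscr (m + 1) X) :
    HasTruncation m X :=
  let ⟨_, ⟨e⟩⟩ := h
  hasTruncation_of_iso e.symm (hasTruncation_disc m _)

lemma IsDiscr.trunc {m : ℕ} {X : MSCat.{u} (m + 1)} (h : IsDiscr (m + 1) X) :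
    IsDiscr m ((trunc m).obj X) :=
  let ⟨A, ⟨e⟩⟩ := h
  ⟨A, ⟨(WGlob.trunc m).mapIso e ≪≫ (discCompTrunc m).app A⟩⟩

lemma IsDiscr.lev {m : ℕ} {X : MSCat.{u} (m + 1)} (h : IsDiscr (m + 1) X) (k : ℕ) :
    IsDiscr m ((lev m k).obj X) :=
  let ⟨A, ⟨e⟩⟩ := h
  ⟨A, ⟨(WGlob.lev m k).mapIso (e ≪≫ (discSuccIso m).app A)⟩⟩

lemma IsDiscr.isCatLike : ∀ {m : ℕ} {X : MSCat.{u} m}, IsDiscr m X → IsCatLike m X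
  | 0, _, ⟨A, ⟨e⟩⟩ => ⟨typeToCat.obj A, ⟨e⟩⟩
  | m + 1, _, ⟨A, ⟨e⟩⟩ => ⟨typeToCat.obj A, ⟨e ≪≫ (discSuccIso m).app A ≪≫
      (constCompWhiskering (disc m)).symm.app A ≪≫
        (discLev m).mapIso (typeToCatCompNerve.symm.app A)⟩⟩

lemma IsCatLike.levDisc {m : ℕ} {X : MSCat.{u} (m + 1)} (h : IsCatLike (m + 1) X) :
    LevDisc (m + 1) X :=
  let ⟨C, ⟨e⟩⟩ := h
  levDisc_of_iso e.symm (levDisc_discLev m (nerve C))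

lemma IsCatLike.hasTruncation {m : ℕ} {X : MSCat.{u} (m + 1)} (h : IsCatLike (m + 1) X) :
    HasTruncation m X :=
  let ⟨_, ⟨e⟩⟩ := h
  hasTruncation_of_iso e.symm (hasTruncation_catIncl m _)

lemma IsCatLike.trunc {m : ℕ} {X : MSCat.{u} (m + 1)} (h : IsCatLike (m + 1) X) :
    IsCatLike m ((trunc m).obj X) :=
  let ⟨C, ⟨e⟩⟩ := h
  ⟨C, ⟨(WGlob.trunc m).mapIso e ≪≫ (catInclCompTrunc m).app C⟩⟩

lemma IsCatLike.lev {m : ℕ} {X : MSCat.{u} (m + 1)} (h : IsCatLike (m + 1) X) (k : ℕ) :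
    IsDiscr m ((lev m k).obj X) :=
  let ⟨C, ⟨e⟩⟩ := h
  ⟨(nerve C).obj (op (SimplexCategory.mk k)), ⟨(WGlob.lev m k).mapIso e⟩⟩

/-- Maps between discrete objects have discrete pullbacks. -/
lemma isDiscr_of_isPullback {m : ℕ} {P X Y Z : MSCat.{u} m} {p : P ⟶ X} {q : P ⟶ Y} {f : X ⟶ Z}
    {g : Y ⟶ Z} (h : IsPullback p q f g) (hX : IsDiscr m X) (hY : IsDiscr m Y)
    (hZ : IsDiscr m Z) : IsDiscr m P := by
  obtain ⟨A, ⟨a⟩⟩ := hX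
  obtain ⟨B, ⟨b⟩⟩ := hY
  obtain ⟨D, ⟨d⟩⟩ := hZ
  let f' : A ⟶ D := (disc m).preimage (a.inv ≫ f ≫ d.hom)
  let g' : B ⟶ D := (disc m).preimage (b.inv ≫ g ≫ d.hom)
  have h' : IsPullback (p ≫ a.hom) (q ≫ b.hom) ((disc m).map f') ((disc m).map g') :=
    h.of_iso (Iso.refl _) a b d (by simp) (by simp) (by simp [f']) (by simp [g'])
  exact ⟨_, ⟨h'.isoIsPullback _ _ ((IsPullback.of_hasPullback f' g').map (disc m))⟩⟩

/-! ### The set of objects -/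

/-- The set of objects of the category `X_{0⋯0}`. -/
def objSet : ∀ m : ℕ, MSCat.{u} m ⥤ Type u
  | 0 => Cat.objects.{u, u}
  | m + 1 => lev m 0 ⋙ objSet m

/-- The object `[0]` of `Δ` is terminal, so that constant simplicial objects are left adjoint to
evaluation at `[0]`. -/
def constAdj (C : Type*) [Category* C] : SimplicialObject.const C ⊣
    (evaluation SimplexCategoryᵒᵖ C).obj (op (SimplexCategory.mk 0)) :=
  Adjunction.mkOfUnitCounit
    { unit := { app := fun X => 𝟙 X }
      counit :=
        { app := fun X =>
            { app := fun k => X.map (SimplexCategory.isTerminalZero.from k.unop).op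
              naturality := fun k l f => by
                simp only [evaluation_obj_obj, Functor.comp_obj, SimplicialObject.const,
                  Functor.const_obj_obj, Functor.const_obj_map, Category.id_comp, Functor.id_obj]
                rw [← X.map_comp]
                congr 1 }
          naturality := fun X Y f => by
            ext k
            exact (f.naturality _).symm }
      left_triangle := by
        ext X k
        simp [SimplicialObject.const]
      right_triangle := by
        ext X
        simp }

/-- Discrete objects are left adjoint to the set of objects. -/
def discAdj : ∀ m : ℕ, disc.{u} m ⊣ objSet.{u} m
  | 0 => Cat.typeToCatObjectsAdj
  | m + 1 => ((discAdj m).comp (constAdj (MSCat.{u} m))).ofNatIsoLeft (discSuccIso m).symm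

instance (m : ℕ) : (objSet.{u} m).IsRightAdjoint := (discAdj m).isRightAdjoint

instance (m : ℕ) (A : Type u) : IsIso ((discAdj m).unit.app A) := inferInstance

/-! ### Discretization maps -/

lemma IsHomDisc.lev {m : ℕ} {X : MSCat.{u} (m + 1)} (h : IsHomDisc (m + 1) X) (k : ℕ) :
    IsHomDisc m ((lev m k).obj X) := h.1 k

lemma IsHomDisc.isSegal {m : ℕ} {X : MSCat.{u} (m + 1)} (h : IsHomDisc (m + 1) X) :
    IsSegal ((toSimp m).obj X) := h.2.1

lemma IsHomDisc.hasTruncation {m : ℕ} {X : MSCat.{u} (m + 1)} (h : IsHomDisc (m + 1) X) :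
    HasTruncation m X := h.2.2.1

lemma IsHomDisc.trunc {m : ℕ} {X : MSCat.{u} (m + 1)} (h : IsHomDisc (m + 1) X) :
    IsHomDisc m ((trunc m).obj X) := h.2.2.2

lemma map_comp_comp_surjective {C : Type*} [Category* C] (F : C ⥤ Type u) {X₁ X₂ X₃ X₄ : C}
    (f : X₁ ⟶ X₂) (g : X₂ ⟶ X₃) (h : X₃ ⟶ X₄) (hf : Function.Surjective (F.map f)) (hg : IsIso g)
    (hh : Function.Surjective (F.map h)) : Function.Surjective (F.map ((f ≫ g) ≫ h)) := by
  have hg' : Function.Surjective (F.map g) := ((isIso_iff_bijective _).1 inferInstance).2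
  intro y
  obtain ⟨x₃, rfl⟩ := hh y
  obtain ⟨x₂, rfl⟩ := hg' x₃
  obtain ⟨x₁, rfl⟩ := hf x₂
  exact ⟨x₁, by simp⟩

lemma isIso_map_comp_comp {C D : Type*} [Category* C] [Category* D] (F : C ⥤ D)
    {X₁ X₂ X₃ X₄ : C} (f : X₁ ⟶ X₂) (g : X₂ ⟶ X₃) (h : X₃ ⟶ X₄) (hf : IsIso (F.map f))
    (hg : IsIso g) (hh : IsIso (F.map h)) : IsIso (F.map ((f ≫ g) ≫ h)) := by
  rw [F.map_comp, F.map_comp]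
  infer_instance

lemma isIso_map_of_isIso {C D : Type*} [Category* C] [Category* D] (F : C ⥤ D) {X Y : C}
    {f : X ⟶ Y} (hf : IsIso f) : IsIso (F.map f) := inferInstance

lemma isIso_toClasses {C : Cat.{u, u}} (h : IsGpd C) (hC : IsDiscCat C) :
    IsIso (toClasses C h) := by
  let G : typeToCat.obj (isomorphismClasses.obj C) ⟶ C :=
    (Discrete.functor (Quotient.lift (s := isIsomorphicSetoid C) id
      (fun _ _ ⟨e⟩ => hC.eq_of_hom e.hom))).toCatHom
  refine ⟨G, ?_, ?_⟩
  · apply Cat.Hom.ext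
    exact CategoryTheory.Functor.ext (fun x => rfl)
      (fun x y f => (hC.subsingleton _ _).elim _ _)
  · apply Cat.Hom.ext
    exact CategoryTheory.Functor.ext (by rintro ⟨⟨x⟩⟩; rfl)
      (fun x y f => Subsingleton.elim (α := (_ : Discrete _) ⟶ _) _ _)

lemma isIso_toClassesBar : ∀ {m : ℕ} {X : MSCat.{u} m} (h : LevelGroupoid m X),
    LevDisc m X → IsIso (toClassesBar m X h)
  | 0, _, h, hX => isIso_toClasses h hX
  | _ + 1, _, h, hX => (isIso_iff_lev _).2 fun k => isIso_toClassesBar (h k) (hX k)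

/-- The discretization map of a discrete object is an isomorphism. -/
lemma isIso_gamma : ∀ {m : ℕ} {X : MSCat.{u} m} (h : IsHomDisc m X), IsDiscr m X →
    IsIso (gamma m X h)
  | 0, _, h, hX => isIso_toClasses h.2 hX.levDisc
  | m + 1, _, h, hX =>
    IsIso.comp_isIso' (IsIso.comp_isIso' (isIso_toClassesBar h.levelGroupoid hX.levDisc)
      (isIso_map_of_isIso (dBar (m + 1)) h.hasTruncation))
      (isIso_map_of_isIso (dIncl m) (isIso_gamma h.trunc hX.trunc))

lemma objSet_toClassesBar_surjective : ∀ {m : ℕ} {X : MSCat.{u} m} (h : LevelGroupoid m X),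
    Function.Surjective ((objSet m).map (toClassesBar m X h))
  | 0, X, h => by
    rintro ⟨⟨x⟩⟩
    exact ⟨x, rfl⟩
  | _ + 1, _, h => objSet_toClassesBar_surjective (h 0)

lemma objects_nerve_surjective {C D : Cat.{u, u}} (F : C ⟶ D)
    (h : Function.Surjective F.toFunctor.obj) :
    Function.Surjective ((nerveMap F.toFunctor).app (op (SimplexCategory.mk 0))) := by
  intro y
  obtain ⟨x, hx⟩ := h (nerveEquiv y)
  exact ⟨nerveEquiv.symm x, nerveEquiv.injective hx⟩

lemma objSet_dIncl_surjective : ∀ {m : ℕ} {X Y : MSCat.{u} m} (f : X ⟶ Y),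
    Function.Surjective ((objSet m).map f) →
      Function.Surjective ((objSet (m + 1)).map ((dIncl m).map f))
  | 0, X, Y, f, h => by
    rintro ⟨y⟩
    obtain ⟨x, hx⟩ := objects_nerve_surjective f h y
    exact ⟨⟨x⟩, congrArg Discrete.mk hx⟩
  | m + 1, X, Y, f, h => objSet_dIncl_surjective ((WGlob.lev m 0).map f) h

/-- The discretization map is surjective on objects. -/
lemma objSet_gamma_surjective : ∀ {m : ℕ} {X : MSCat.{u} m} (h : IsHomDisc m X),
    Function.Surjective ((objSet m).map (gamma m X h))
  | 0, _, h => objSet_toClassesBar_surjective (m := 0) h.2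
  | m + 1, _, h => map_comp_comp_surjective (objSet (m + 1)) _ _ _
      (objSet_toClassesBar_surjective h.levelGroupoid)
      (isIso_map_of_isIso (dBar (m + 1)) h.hasTruncation)
      (objSet_dIncl_surjective _ (objSet_gamma_surjective h.trunc))

lemma isIso_isomorphismClasses_toClasses {C : Cat.{u, u}} (h : IsGpd C) :
    IsIso (isomorphismClasses.map (toClasses C h)) := by
  refine (isIso_iff_bijective _).2 ⟨?_, ?_⟩
  · rintro ⟨x⟩ ⟨y⟩ hxy
    obtain ⟨e⟩ : IsIsomorphic _ _ := Quotient.exact hxy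
    exact Discrete.eq_of_hom e.hom
  · rintro ⟨⟨⟨x⟩⟩⟩
    exact ⟨Quotient.mk _ x, rfl⟩

lemma isIso_pBar_toClassesBar : ∀ {m : ℕ} {X : MSCat.{u} m} (h : LevelGroupoid m X),
    IsIso ((pBar m).map (toClassesBar m X h))
  | 0, _, h => isIso_isomorphismClasses_toClasses h
  | _ + 1, _, h => (isIso_iff_levSet _).2 fun k => isIso_pBar_toClassesBar (h k)

/-- The discretization map is a bijection on `p⁽¹⁾ ⋯ p⁽ⁿ⁾`. -/
lemma isIso_classes_gamma : ∀ {m : ℕ} {X : MSCat.{u} m} (h : IsHomDisc m X),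
    IsIso ((classes m).map (gamma m X h))
  | 0, _, h => isIso_isomorphismClasses_toClasses h.2
  | m + 1, _, h => isIso_map_comp_comp (classes (m + 1)) _ _ _
      (isIso_map_of_isIso (unnerve m ⋙ classes m) (isIso_pBar_toClassesBar h.levelGroupoid))
      (isIso_map_of_isIso (dBar (m + 1)) h.hasTruncation)
      ((NatIso.isIso_map_iff (Functor.isoWhiskerRight (dInclCompTrunc m) (classes m)) _).2
        (isIso_classes_gamma h.trunc))

/-! ### Segal maps and limits -/

section Segal

variable {C : Type*} [Category* C]

/-- A family of maps `T ⟶ X_1` with matching endpoints, after composition with `γ : X_0 ⟶ B`. -/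
def IsChain (X : SimplicialObject C) {B : C} (γ : X.obj (op (SimplexCategory.mk 0)) ⟶ B) {k : ℕ}
    {T : C} (t : Fin k → (T ⟶ X.obj (op (SimplexCategory.mk 1)))) : Prop :=
  ∀ j : Fin (k - 1), t ⟨j, by omega⟩ ≫ X.δ 0 ≫ γ = t ⟨j + 1, by omega⟩ ≫ X.δ 1 ≫ γ

lemma IsChain.comp {X : SimplicialObject C} {B : C}
    {γ : X.obj (op (SimplexCategory.mk 0)) ⟶ B} {k : ℕ} {T : C}
    {t : Fin k → (T ⟶ X.obj (op (SimplexCategory.mk 1)))} (h : IsChain X γ t) {S : C} (s : S ⟶ T) :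
    IsChain X γ (fun j => s ≫ t j) := fun j => by
  simp only [Category.assoc]
  rw [h j]

variable [HasLimitsOfSize.{0, 0} C]

/-- The projections of a fibre power. -/
def fibrePowerProj (X : SimplicialObject C) {B : C} (γ : X.obj (op (SimplexCategory.mk 0)) ⟶ B)
    (k : ℕ) (j : Fin k) : fibrePower X γ k ⟶ X.obj (op (SimplexCategory.mk 1)) :=
  Multiequalizer.ι (zigzag X γ k) j

lemma inducedSegalMap_proj (X : SimplicialObject C) {B : C}
    (γ : X.obj (op (SimplexCategory.mk 0)) ⟶ B) (k : ℕ) (j : Fin k) :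
    inducedSegalMap X γ k ≫ fibrePowerProj X γ k j = nu X j :=
  Multiequalizer.lift_ι _ _ _ _ _

lemma fibrePower_hom_ext (X : SimplicialObject C) {B : C}
    (γ : X.obj (op (SimplexCategory.mk 0)) ⟶ B) (k : ℕ) {T : C} {s t : T ⟶ fibrePower X γ k}
    (h : ∀ j, s ≫ fibrePowerProj X γ k j = t ≫ fibrePowerProj X γ k j) : s = t :=
  Multiequalizer.hom_ext _ _ _ h

lemma fibrePower_isChain (X : SimplicialObject C) {B : C}
    (γ : X.obj (op (SimplexCategory.mk 0)) ⟶ B) (k : ℕ) : IsChain X γ (fibrePowerProj X γ k) :=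
  fun j => Multiequalizer.condition (zigzag X γ k) j

lemma fibrePower_exists_lift (X : SimplicialObject C) {B : C}
    (γ : X.obj (op (SimplexCategory.mk 0)) ⟶ B) (k : ℕ) {T : C}
    {t : Fin k → (T ⟶ X.obj (op (SimplexCategory.mk 1)))} (h : IsChain X γ t) :
    ∃ s : T ⟶ fibrePower X γ k, ∀ j, s ≫ fibrePowerProj X γ k j = t j :=
  ⟨Multiequalizer.lift (zigzag X γ k) _ t h, fun _ => Multiequalizer.lift_ι _ _ _ _ _⟩

/-- The Segal map is an isomorphism if and only if `X_k` has the universal property of the fibre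
power. -/
lemma isIso_inducedSegalMap_iff (X : SimplicialObject C) {B : C}
    (γ : X.obj (op (SimplexCategory.mk 0)) ⟶ B) (k : ℕ) :
    IsIso (inducedSegalMap X γ k) ↔
      ∀ (T : C) (t : Fin k → (T ⟶ X.obj (op (SimplexCategory.mk 1)))), IsChain X γ t →
        ∃! s : T ⟶ X.obj (op (SimplexCategory.mk k)), ∀ j, s ≫ nu X j = t j := by
  constructor
  · intro _ T t h
    obtain ⟨s, hs⟩ := fibrePower_exists_lift X γ k h
    refine ⟨s ≫ inv (inducedSegalMap X γ k), fun j => ?_, fun s' hs' => ?_⟩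
    · rw [← inducedSegalMap_proj X γ k j, ← hs j]
      simp
    · rw [IsIso.eq_comp_inv]
      refine fibrePower_hom_ext _ _ _ fun j => ?_
      rw [Category.assoc, inducedSegalMap_proj, hs', hs]
  · intro H
    obtain ⟨s, hs, -⟩ := H _ _ (fibrePower_isChain X γ k)
    have hs' : s ≫ inducedSegalMap X γ k = 𝟙 _ := by
      refine fibrePower_hom_ext _ _ _ fun j => ?_
      rw [Category.assoc, inducedSegalMap_proj, hs, Category.id_comp]
    refine ⟨s, ?_, hs'⟩
    refine (H _ _ ((fibrePower_isChain X γ k).comp (inducedSegalMap X γ k))).unique ?_ ?_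
    · intro j
      rw [Category.assoc, hs]
    · intro j
      rw [Category.id_comp, inducedSegalMap_proj]

/-- Replacing `X_0` by an object it embeds into does not change the fibre powers. -/
lemma isIso_inducedSegalMap_of_mono (X : SimplicialObject C) {B : C}
    (γ : X.obj (op (SimplexCategory.mk 0)) ⟶ B) (hγ : Mono γ) (k : ℕ)
    (h : IsIso (inducedSegalMap X (𝟙 _) k)) : IsIso (inducedSegalMap X γ k) := by
  rw [isIso_inducedSegalMap_iff] at h ⊢
  intro T t ht
  refine h T t fun j => ?_
  have := ht j
  rw [← Category.assoc, ← Category.assoc, cancel_mono] at this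
  rw [Category.comp_id, Category.comp_id, this]

/-- The functoriality of fibre powers. -/
def fibrePowerMap {X Y : SimplicialObject C} (f : X ⟶ Y) {B B' : C}
    (γ : X.obj (op (SimplexCategory.mk 0)) ⟶ B) (γ' : Y.obj (op (SimplexCategory.mk 0)) ⟶ B')
    (b : B ⟶ B') (w : f.app _ ≫ γ' = γ ≫ b) (k : ℕ) : fibrePower X γ k ⟶ fibrePower Y γ' k :=
  Multiequalizer.lift (zigzag Y γ' k) _ (fun j => fibrePowerProj X γ k j ≫ f.app _) fun j => by
    have h := fibrePower_isChain X γ k j =≫ b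
    simp only [Category.assoc, ← w] at h
    have h₀ : f.app _ ≫ Y.δ 0 = X.δ 0 ≫ f.app (op (SimplexCategory.mk 0)) :=
      (f.naturality _).symm
    have h₁ : f.app _ ≫ Y.δ 1 = X.δ 1 ≫ f.app (op (SimplexCategory.mk 0)) :=
      (f.naturality _).symm
    dsimp
    simp only [Category.assoc]
    rw [reassoc_of% h₀, reassoc_of% h₁]
    exact h

lemma fibrePowerMap_proj {X Y : SimplicialObject C} (f : X ⟶ Y) {B B' : C}
    (γ : X.obj (op (SimplexCategory.mk 0)) ⟶ B) (γ' : Y.obj (op (SimplexCategory.mk 0)) ⟶ B')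
    (b : B ⟶ B') (w : f.app _ ≫ γ' = γ ≫ b) (k : ℕ) (j : Fin k) :
    fibrePowerMap f γ γ' b w k ≫ fibrePowerProj Y γ' k j = fibrePowerProj X γ k j ≫ f.app _ :=
  Multiequalizer.lift_ι _ _ _ _ _

lemma inducedSegalMap_naturality {X Y : SimplicialObject C} (f : X ⟶ Y) {B B' : C}
    (γ : X.obj (op (SimplexCategory.mk 0)) ⟶ B) (γ' : Y.obj (op (SimplexCategory.mk 0)) ⟶ B')
    (b : B ⟶ B') (w : f.app _ ≫ γ' = γ ≫ b) (k : ℕ) :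
    f.app _ ≫ inducedSegalMap Y γ' k = inducedSegalMap X γ k ≫ fibrePowerMap f γ γ' b w k := by
  refine fibrePower_hom_ext _ _ _ fun j => ?_
  rw [Category.assoc, Category.assoc, inducedSegalMap_proj, fibrePowerMap_proj,
    ← Category.assoc, inducedSegalMap_proj]
  exact (f.naturality _).symm

/-- Fibre powers commute with pullbacks. -/
lemma isPullback_fibrePowerMap {P X Y Z : SimplicialObject C} {p : P ⟶ X} {q : P ⟶ Y} {f : X ⟶ Z}
    {g : Y ⟶ Z} {BP BX BY BZ : C} {bp : BP ⟶ BX} {bq : BP ⟶ BY} {bf : BX ⟶ BZ} {bg : BY ⟶ BZ}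
    (h : IsPullback p q f g) (hB : IsPullback bp bq bf bg)
    {γP : P.obj (op (SimplexCategory.mk 0)) ⟶ BP} {γX : X.obj (op (SimplexCategory.mk 0)) ⟶ BX}
    {γY : Y.obj (op (SimplexCategory.mk 0)) ⟶ BY} {γZ : Z.obj (op (SimplexCategory.mk 0)) ⟶ BZ}
    (wp : p.app _ ≫ γX = γP ≫ bp) (wq : q.app _ ≫ γY = γP ≫ bq) (wf : f.app _ ≫ γZ = γX ≫ bf)
    (wg : g.app _ ≫ γZ = γY ≫ bg) (k : ℕ) :
    IsPullback (fibrePowerMap p γP γX bp wp k) (fibrePowerMap q γP γY bq wq k)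
      (fibrePowerMap f γX γZ bf wf k) (fibrePowerMap g γY γZ bg wg k) := by
  have h₁ := h.app (op (SimplexCategory.mk 1))
  refine IsPullback.mk' ?_ ?_ ?_
  · refine fibrePower_hom_ext _ _ _ fun j => ?_
    simp only [Category.assoc, fibrePowerMap_proj]
    rw [← Category.assoc, ← Category.assoc, fibrePowerMap_proj, fibrePowerMap_proj,
      Category.assoc, Category.assoc, h₁.w]
  · intro T s t hs ht
    refine fibrePower_hom_ext _ _ _ fun j => h₁.hom_ext ?_ ?_
    · have := hs =≫ fibrePowerProj X γX k j
      simpa only [Category.assoc, fibrePowerMap_proj] using this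
    · have := ht =≫ fibrePowerProj Y γY k j
      simpa only [Category.assoc, fibrePowerMap_proj] using this
  · intro T a b hab
    have key (j : Fin k) := h₁.exists_lift (a ≫ fibrePowerProj X γX k j)
      (b ≫ fibrePowerProj Y γY k j) (by
        have := hab =≫ fibrePowerProj Z γZ k j
        simpa only [Category.assoc, fibrePowerMap_proj] using this)
    choose t ht₁ ht₂ using key
    have hd (i : Fin 2) : P.δ i ≫ p.app _ = p.app _ ≫ X.δ i := p.naturality _
    have hd' (i : Fin 2) : P.δ i ≫ q.app _ = q.app _ ≫ Y.δ i := q.naturality _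
    obtain ⟨s, hs⟩ := fibrePower_exists_lift P γP k (t := t) (fun j => by
      apply hB.hom_ext
      · simp only [Category.assoc, ← wp]
        rw [reassoc_of% hd, reassoc_of% hd, reassoc_of% ht₁, reassoc_of% ht₁]
        simpa only [Category.assoc] using (fibrePower_isChain X γX k).comp a j
      · simp only [Category.assoc, ← wq]
        rw [reassoc_of% hd', reassoc_of% hd', reassoc_of% ht₂, reassoc_of% ht₂]
        simpa only [Category.assoc] using (fibrePower_isChain Y γY k).comp b j)
    refine ⟨s, fibrePower_hom_ext _ _ _ fun j => ?_, fibrePower_hom_ext _ _ _ fun j => ?_⟩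
    · rw [Category.assoc, fibrePowerMap_proj, ← Category.assoc, hs, ht₁]
    · rw [Category.assoc, fibrePowerMap_proj, ← Category.assoc, hs, ht₂]

/-- The Segal condition is stable under pullbacks. -/
lemma isSegal_of_isPullback {P X Y Z : SimplicialObject C} {p : P ⟶ X} {q : P ⟶ Y} {f : X ⟶ Z}
    {g : Y ⟶ Z} (h : IsPullback p q f g) (hX : IsSegal X) (hY : IsSegal Y) (hZ : IsSegal Z) :
    IsSegal P := fun k hk => by
  have := hX k hk
  have := hY k hk
  have := hZ k hk
  have w {X Y : SimplicialObject C} (f : X ⟶ Y) : f.app (op (SimplexCategory.mk 0)) ≫ 𝟙 _ =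
      𝟙 _ ≫ f.app (op (SimplexCategory.mk 0)) := by simp
  exact isIso_of_isPullbacks (h.app (op (SimplexCategory.mk k)))
    (isPullback_fibrePowerMap h (h.app (op (SimplexCategory.mk 0))) (w p) (w q) (w f) (w g) k)
    (inducedSegalMap_naturality _ _ _ _ _ _) (inducedSegalMap_naturality _ _ _ _ _ _)
    (inducedSegalMap_naturality _ _ _ _ _ _) (inducedSegalMap_naturality _ _ _ _ _ _)

lemma isSegal_of_iso {X Y : SimplicialObject C} (e : X ≅ Y) (h : IsSegal X) : IsSegal Y :=
  isSegal_of_isPullback (IsPullback.of_horiz_isIso ⟨rfl⟩ :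
    IsPullback e.inv e.inv (𝟙 X) (𝟙 X)) h h h

/-- Right adjoints preserve the Segal condition. -/
lemma isSegal_whiskering {D : Type*} [Category* D] [HasLimitsOfSize.{0, 0} D] {L : D ⥤ C}
    {G : C ⥤ D} (adj : L ⊣ G) {X : SimplicialObject C} (h : IsSegal X) :
    IsSegal (((SimplicialObject.whiskering C D).obj G).obj X) := fun k hk => by
  rw [isIso_inducedSegalMap_iff]
  intro T t ht
  have key {A B : C} (a : T ⟶ G.obj A) (f : A ⟶ B) :
      (adj.homEquiv _ _).symm a ≫ f = (adj.homEquiv _ _).symm (a ≫ G.map f) :=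
    (adj.homEquiv_naturality_right_symm _ _).symm
  obtain ⟨s, hs, hs'⟩ := (isIso_inducedSegalMap_iff X (𝟙 _) k).1 (h k hk) (L.obj T)
    (fun j => (adj.homEquiv _ _).symm (t j)) (fun j => by
      have := ht j
      rw [Category.comp_id, Category.comp_id] at this ⊢
      exact (key _ _).trans ((congrArg (adj.homEquiv _ _).symm this).trans (key _ _).symm))
  refine ⟨adj.homEquiv _ _ s, fun j => (adj.homEquiv _ _).symm.injective ?_, fun s₂ hs₂ =>
    ((adj.homEquiv _ _).symm_apply_eq).1 (hs' _ fun j => ?_)⟩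
  · refine (key _ _).symm.trans (Eq.trans ?_ (hs j))
    exact congrArg (· ≫ nu X j) (Equiv.symm_apply_apply _ _)
  · exact (key _ _).trans (congrArg (adj.homEquiv _ _).symm (hs₂ j))

lemma isIso_fibrePowerProj_one (X : SimplicialObject C) {B : C}
    (γ : X.obj (op (SimplexCategory.mk 0)) ⟶ B) : IsIso (fibrePowerProj X γ 1 0) := by
  obtain ⟨s, hs⟩ := fibrePower_exists_lift X γ 1 (t := fun _ => 𝟙 _) (fun j => j.elim0)
  refine ⟨s, fibrePower_hom_ext _ _ _ fun j => ?_, hs 0⟩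
  obtain rfl : j = 0 := Subsingleton.elim _ _
  rw [Category.assoc, hs, Category.comp_id, Category.id_comp]

/-- Fibre powers are iterated pullbacks. -/
lemma exists_isPullback_fibrePower (X : SimplicialObject C) {B : C}
    (γ : X.obj (op (SimplexCategory.mk 0)) ⟶ B) (k : ℕ) :
    ∃ i : fibrePower X γ (k + 2) ⟶ fibrePower X γ (k + 1),
      IsPullback i (fibrePowerProj X γ (k + 2) (Fin.last (k + 1)))
        (fibrePowerProj X γ (k + 1) (Fin.last k) ≫ X.δ 0 ≫ γ) (X.δ 1 ≫ γ) := by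
  have hc := fibrePower_isChain X γ (k + 2)
  obtain ⟨i, hi⟩ := fibrePower_exists_lift X γ (k + 1)
    (t := fun j => fibrePowerProj X γ (k + 2) j.castSucc)
    (fun j => hc ⟨j, by omega⟩)
  refine ⟨i, IsPullback.mk' ?_ ?_ ?_⟩
  · rw [← Category.assoc, hi]
    exact hc (Fin.last k)
  · intro T s t h₁ h₂
    refine fibrePower_hom_ext _ _ _ fun j => ?_
    induction j using Fin.lastCases with
    | last => exact h₂
    | cast j => rw [← hi, reassoc_of% h₁]
  · intro T a b hab
    obtain ⟨s, hs⟩ := fibrePower_exists_lift X γ (k + 2)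
      (t := Fin.lastCases b (fun j => a ≫ fibrePowerProj X γ (k + 1) j)) (fun ⟨j, hj⟩ => by
        obtain rfl | hj' : j = k ∨ j < k := by omega
        · have e₁ : (⟨j, by omega⟩ : Fin (j + 2)) = (Fin.last j).castSucc := rfl
          have e₂ : (⟨j + 1, by omega⟩ : Fin (j + 2)) = Fin.last (j + 1) := rfl
          rw [e₁, e₂]
          beta_reduce
          rw [Fin.lastCases_castSucc, Fin.lastCases_last, Category.assoc]
          exact hab
        · have e₁ : (⟨j, by omega⟩ : Fin (k + 2)) = (⟨j, by omega⟩ : Fin (k + 1)).castSucc := rfl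
          have e₂ : (⟨j + 1, by omega⟩ : Fin (k + 2)) =
            (⟨j + 1, by omega⟩ : Fin (k + 1)).castSucc := rfl
          rw [e₁, e₂]
          beta_reduce
          rw [Fin.lastCases_castSucc, Fin.lastCases_castSucc]
          exact (fibrePower_isChain X γ (k + 1)).comp a ⟨j, by omega⟩)
    refine ⟨s, fibrePower_hom_ext _ _ _ fun j => ?_, ?_⟩
    · rw [Category.assoc, hi, hs, Fin.lastCases_castSucc]
    · rw [hs, Fin.lastCases_last]

end Segal

/-- The nerve of a category satisfies the Segal condition. -/
lemma isSegal_nerve (C : Cat.{u, u}) : IsSegal (C := Type u) (nerve C) := fun k hk => by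
  rw [isIso_inducedSegalMap_iff]
  intro T t ht
  -- A family of composable morphisms is a path in the nerve, hence the spine of a unique simplex.
  let vertex (x : T) (i : Fin (k + 1)) : (nerve C).obj (op (SimplexCategory.mk 0)) :=
    Fin.cases ((nerve C).δ 1 (t ⟨0, by omega⟩ x)) (fun j => (nerve C).δ 0 (t j x)) i
  let path (x : T) : (nerve C).Path k :=
    { vertex := vertex x
      arrow := fun j => t j x
      arrow_src := fun ⟨i, hi⟩ => by
        obtain _ | i := i
        · rfl
        · exact (ConcreteCategory.congr_hom (ht ⟨i, by omega⟩) x).symm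
      arrow_tgt := fun i => rfl }
  let S := Nerve.strictSegal C
  refine ⟨↾fun x => S.spineToSimplex (path x), fun j => ?_, fun s hs => ?_⟩
  · ext x
    exact S.spineToSimplex_arrow j (path x)
  · ext x
    refine S.spineInjective ?_
    refine Eq.trans ?_ (S.spine_spineToSimplex_apply (path x)).symm
    obtain ⟨k, rfl⟩ : ∃ l, k = l + 1 := ⟨k - 1, by omega⟩
    exact SSet.Path.ext' fun i => ConcreteCategory.congr_hom (hs i) x

lemma IsCatLike.isSegal {m : ℕ} {X : MSCat.{u} (m + 1)} (h : IsCatLike (m + 1) X) :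
    IsSegal ((toSimp m).obj X) := by
  obtain ⟨C, ⟨e⟩⟩ := h
  exact isSegal_of_iso ((toSimp m).mapIso e.symm) (isSegal_whiskering (C := Type u)
    (Adjunction.ofIsRightAdjoint (disc m)) (isSegal_nerve C))

/-! ### Homotopically discrete objects and pullbacks -/

lemma IsDiscCat.isEquivRel {C : Cat.{u, u}} (h : IsDiscCat C) : IsEquivRel C :=
  have : CategoryTheory.IsDiscrete C := h
  ⟨fun _ _ => inferInstance, ⟨fun _ => inferInstance⟩⟩

lemma IsDiscCat.isThin {C : Cat.{u, u}} (h : IsDiscCat C) : Quiver.IsThin C := h.subsingleton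

lemma isSegal_of_isPullback_toSimp {m : ℕ} {P X Y Z : MSCat.{u} (m + 1)} {p : P ⟶ X} {q : P ⟶ Y}
    {f : X ⟶ Z} {g : Y ⟶ Z} (h : IsPullback p q f g) (hX : IsSegal ((toSimp m).obj X))
    (hY : IsSegal ((toSimp m).obj Y)) (hZ : IsSegal ((toSimp m).obj Z)) :
    IsSegal ((toSimp m).obj P) :=
  isSegal_of_isPullback (C := MSCat.{u} m) (p := (toSimp m).map p) (q := (toSimp m).map q)
    (f := (toSimp m).map f) (g := (toSimp m).map g) h hX hY hZ

/-- Discrete objects are homotopically discrete. -/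
lemma IsDiscr.isHomDisc : ∀ {m : ℕ} {X : MSCat.{u} m}, IsDiscr m X → IsHomDisc m X
  | 0, _, h => IsDiscCat.isEquivRel h.levDisc
  | _ + 1, _, h => ⟨fun k => (h.lev k).isHomDisc, h.isCatLike.isSegal, h.hasTruncation,
      h.trunc.isHomDisc⟩

/-- Homotopically discrete objects are stable under pullbacks over discrete objects. -/
lemma isHomDisc_of_isPullback : ∀ {m : ℕ} {P X Y Z : MSCat.{u} m} {p : P ⟶ X} {q : P ⟶ Y}
    {f : X ⟶ Z} {g : Y ⟶ Z}, IsPullback p q f g → IsHomDisc m X → IsHomDisc m Y → IsDiscr m Z →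
      IsHomDisc m P
  | 0, _, _, _, _, _, _, _, _, h, hX, hY, hZ =>
    have := IsDiscCat.isThin hZ.levDisc
    isEquivRel_of_isPullback h hX hY
  | _ + 1, _, _, _, _, _, _, _, _, h, hX, hY, hZ =>
    ⟨fun k => isHomDisc_of_isPullback (isPullback_iff_lev.1 h k) (hX.lev k) (hY.lev k) (hZ.lev k),
      isSegal_of_isPullback_toSimp h hX.isSegal hY.isSegal hZ.isCatLike.isSegal,
      hasTruncation_of_isPullback h hZ.levDisc hX.hasTruncation hY.hasTruncation hZ.hasTruncation,
      isHomDisc_of_isPullback (isPullback_trunc h hZ.levDisc hX.hasTruncation hY.hasTruncation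
        hZ.hasTruncation) hX.trunc hY.trunc hZ.trunc⟩

/-- The set `p⁽¹⁾ ⋯ p⁽ⁿ⁾ X` is compatible with pullbacks over discrete objects. -/
lemma isPullback_classes : ∀ {m : ℕ} {P X Y Z : MSCat.{u} m} {p : P ⟶ X} {q : P ⟶ Y}
    {f : X ⟶ Z} {g : Y ⟶ Z}, IsPullback p q f g → IsHomDisc m X → IsHomDisc m Y → IsDiscr m Z →
      IsPullback ((classes m).map p) ((classes m).map q) ((classes m).map f) ((classes m).map g)
  | 0, _, _, _, _, _, _, _, _, h, _, _, hZ => isPullback_pBar (m := 0) hZ.levDisc h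
  | _ + 1, _, _, _, _, _, _, _, _, h, hX, hY, hZ =>
    have h' := isPullback_trunc h hZ.levDisc hX.hasTruncation hY.hasTruncation hZ.hasTruncation
    have h'' := isPullback_classes h' hX.trunc hY.trunc hZ.trunc
    h''

lemma isPullback_discretization {m : ℕ} {P X Y Z : MSCat.{u} m} {p : P ⟶ X} {q : P ⟶ Y}
    {f : X ⟶ Z} {g : Y ⟶ Z} (h : IsPullback p q f g) (hX : IsHomDisc m X) (hY : IsHomDisc m Y)
    (hZ : IsDiscr m Z) :
    IsPullback ((discretization m).map p) ((discretization m).map q) ((discretization m).map f)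
      ((discretization m).map g) :=
  (isPullback_classes h hX hY hZ).map (disc m)

/-! ### Hom objects and pullbacks -/

/-- The discrete object on a point is terminal. -/
def isTerminalDiscPUnit (m : ℕ) : IsTerminal ((disc.{u} m).obj PUnit.{u + 1}) :=
  IsTerminal.isTerminalObj (disc m) _ (Types.isTerminalPUnit)

lemma isDiscr_discretization (m : ℕ) (X : MSCat.{u} m) :
    IsDiscr m ((discretization m).obj X) := isDiscr_disc m _

lemma isDiscr_prod {m : ℕ} {X Y : MSCat.{u} m} (hX : IsDiscr m X) (hY : IsDiscr m Y) :
    IsDiscr m (X ⨯ Y) := by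
  refine isDiscr_of_isPullback (IsPullback.of_is_product' (prodIsProd X Y)
    (isTerminalDiscPUnit m)) hX hY (isDiscr_disc m _)

/-- The projection `X(a, b) ⟶ X₁`. -/
def homFst (m : ℕ) (X : MSCat.{u} (m + 1)) (h : IsHomDisc m ((lev m 0).obj X))
    (a b : (classes m).obj ((lev m 0).obj X)) : homObj m X h a b ⟶ (lev m 1).obj X :=
  pullback.fst (endpoints m X h) (prod.lift (point m a) (point m b))

/-- The projection of `X(a, b)` to the point. -/
def homSnd (m : ℕ) (X : MSCat.{u} (m + 1)) (h : IsHomDisc m ((lev m 0).obj X))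
    (a b : (classes m).obj ((lev m 0).obj X)) : homObj m X h a b ⟶ (disc m).obj PUnit.{u + 1} :=
  pullback.snd (endpoints m X h) (prod.lift (point m a) (point m b))

lemma isPullback_homObj (m : ℕ) (X : MSCat.{u} (m + 1)) (h : IsHomDisc m ((lev m 0).obj X))
    (a b : (classes m).obj ((lev m 0).obj X)) :
    IsPullback (homFst m X h a b) (homSnd m X h a b) (endpoints m X h)
      (prod.lift (point m a) (point m b)) :=
  IsPullback.of_hasPullback _ _

/-- The map `f(a, b) : X(a, b) ⟶ Y(a', b')` for points `a'` and `b'` which agree with `f a` and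
`f b`. -/
def homMapTo (m : ℕ) {X Y : MSCat.{u} (m + 1)} (hX : IsHomDisc m ((lev m 0).obj X))
    (hY : IsHomDisc m ((lev m 0).obj Y)) (f : X ⟶ Y)
    {a b : (classes m).obj ((lev m 0).obj X)} {a' b' : (classes m).obj ((lev m 0).obj Y)}
    (ha : (classes m).map ((lev m 0).map f) a = a')
    (hb : (classes m).map ((lev m 0).map f) b = b') :
    homObj m X hX a b ⟶ homObj m Y hY a' b' :=
  pullback.map _ _ _ _ ((lev m 1).map f) (𝟙 _)
    (prod.map ((discretization m).map ((lev m 0).map f))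
      ((discretization m).map ((lev m 0).map f)))
    (endpoints_naturality m hX hY f)
    (by rw [Category.id_comp, prod.lift_map, point_comp, point_comp, ha, hb])

lemma isNEquiv_homMapTo_iff {m : ℕ} {X Y : MSCat.{u} (m + 1)}
    (hX : IsHomDisc m ((lev m 0).obj X)) (hY : IsHomDisc m ((lev m 0).obj Y)) (f : X ⟶ Y)
    {a b : (classes m).obj ((lev m 0).obj X)} {a' b' : (classes m).obj ((lev m 0).obj Y)}
    (ha : (classes m).map ((lev m 0).map f) a = a')
    (hb : (classes m).map ((lev m 0).map f) b = b') :
    IsNEquiv m (homMapTo m hX hY f ha hb) ↔ IsNEquiv m (homMap m hX hY f a b) := by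
  subst ha hb
  rfl

section

variable {m : ℕ} {X Y Z : MSCat.{u} (m + 1)} {hX : IsHomDisc m ((lev m 0).obj X)}
  {hY : IsHomDisc m ((lev m 0).obj Y)} {hZ : IsHomDisc m ((lev m 0).obj Z)} {f : X ⟶ Y} {g : Y ⟶ Z}
  {a b : (classes m).obj ((lev m 0).obj X)} {a' b' : (classes m).obj ((lev m 0).obj Y)}
  {a'' b'' : (classes m).obj ((lev m 0).obj Z)}
  {ha : (classes m).map ((lev m 0).map f) a = a'} {hb : (classes m).map ((lev m 0).map f) b = b'}

lemma homMapTo_fst : homMapTo m hX hY f ha hb ≫ homFst m Y hY a' b' =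
    homFst m X hX a b ≫ (lev m 1).map f := pullback.lift_fst _ _ _

lemma homMapTo_snd : homMapTo m hX hY f ha hb ≫ homSnd m Y hY a' b' =
    homSnd m X hX a b ≫ 𝟙 _ := pullback.lift_snd _ _ _

lemma homMapTo_comp {ha' : (classes m).map ((lev m 0).map g) a' = a''}
    {hb' : (classes m).map ((lev m 0).map g) b' = b''} :
    homMapTo m hX hY f ha hb ≫ homMapTo m hY hZ g ha' hb' =
      homMapTo m hX hZ (f ≫ g) (by simp [ha, ha']) (by simp [hb, hb']) := by
  apply (isPullback_homObj m Z hZ a'' b'').hom_ext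
  · rw [Category.assoc, homMapTo_fst, ← Category.assoc, homMapTo_fst, Category.assoc,
      ← Functor.map_comp, homMapTo_fst]
  · rw [Category.assoc, homMapTo_snd, ← Category.assoc, homMapTo_snd, homMapTo_snd,
      Category.assoc, Category.id_comp]

lemma isIso_homMapTo [IsIso f] : IsIso (homMapTo m hX hY f ha hb) :=
  isIso_of_isPullbacks (isPullback_homObj m X hX a b) (isPullback_homObj m Y hY a' b')
    homMapTo_fst.symm homMapTo_snd.symm (endpoints_naturality m hX hY f)
    (by rw [Category.id_comp, prod.lift_map, point_comp, point_comp, ha, hb])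

end

lemma isPullback_prodMap {C : Type*} [Category* C] [HasBinaryProducts C] {P X Y Z P' X' Y' Z' : C}
    {p : P ⟶ X} {q : P ⟶ Y} {f : X ⟶ Z} {g : Y ⟶ Z} {p' : P' ⟶ X'} {q' : P' ⟶ Y'} {f' : X' ⟶ Z'}
    {g' : Y' ⟶ Z'} (h : IsPullback p q f g) (h' : IsPullback p' q' f' g') :
    IsPullback (prod.map p p') (prod.map q q') (prod.map f f') (prod.map g g') := by
  refine IsPullback.mk' (by simp [h.w, h'.w]) ?_ ?_
  · intro T s t h₁ h₂
    apply Limits.prod.hom_ext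
    · exact h.hom_ext (by simpa using h₁ =≫ prod.fst) (by simpa using h₂ =≫ prod.fst)
    · exact h'.hom_ext (by simpa using h₁ =≫ prod.snd) (by simpa using h₂ =≫ prod.snd)
  · intro T a b hab
    obtain ⟨s, hs₁, hs₂⟩ := h.exists_lift (a ≫ prod.fst) (b ≫ prod.fst)
      (by simpa using hab =≫ prod.fst)
    obtain ⟨t, ht₁, ht₂⟩ := h'.exists_lift (a ≫ prod.snd) (b ≫ prod.snd)
      (by simpa using hab =≫ prod.snd)
    exact ⟨prod.lift s t, by rw [prod.lift_map, hs₁, ht₁, ← prod.comp_lift, prod.lift_fst_snd,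
      Category.comp_id], by rw [prod.lift_map, hs₂, ht₂, ← prod.comp_lift, prod.lift_fst_snd,
      Category.comp_id]⟩

/-- Hom objects are compatible with pullbacks over `Z` if `Z₀` is discrete: they are fibres of
`endpoints`, whose target is compatible with such pullbacks. -/
lemma isPullback_homMapTo {m : ℕ} {P X Y Z : MSCat.{u} (m + 1)} {p : P ⟶ X} {q : P ⟶ Y} {f : X ⟶ Z}
    {g : Y ⟶ Z} (h : IsPullback p q f g) (hP : IsHomDisc m ((lev m 0).obj P))
    (hX : IsHomDisc m ((lev m 0).obj X)) (hY : IsHomDisc m ((lev m 0).obj Y))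
    (hZ : IsHomDisc m ((lev m 0).obj Z)) (hZ' : IsDiscr m ((lev m 0).obj Z))
    {a b : (classes m).obj ((lev m 0).obj P)} {a₁ b₁ : (classes m).obj ((lev m 0).obj X)}
    {a₂ b₂ : (classes m).obj ((lev m 0).obj Y)} {a₃ b₃ : (classes m).obj ((lev m 0).obj Z)}
    (ha₁ : (classes m).map ((lev m 0).map p) a = a₁)
    (hb₁ : (classes m).map ((lev m 0).map p) b = b₁)
    (ha₂ : (classes m).map ((lev m 0).map q) a = a₂)
    (hb₂ : (classes m).map ((lev m 0).map q) b = b₂)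
    (ha₃ : (classes m).map ((lev m 0).map f) a₁ = a₃)
    (hb₃ : (classes m).map ((lev m 0).map f) b₁ = b₃)
    (ha₄ : (classes m).map ((lev m 0).map g) a₂ = a₃)
    (hb₄ : (classes m).map ((lev m 0).map g) b₂ = b₃) :
    IsPullback (homMapTo m hP hX p ha₁ hb₁) (homMapTo m hP hY q ha₂ hb₂)
      (homMapTo m hX hZ f ha₃ hb₃) (homMapTo m hY hZ g ha₄ hb₄) := by
  have h₀ := isPullback_discretization (isPullback_iff_lev.1 h 0) hX hY hZ'
  have hpt : IsPullback (𝟙 ((disc.{u} m).obj PUnit.{u + 1})) (𝟙 _) (𝟙 _) (𝟙 _) :=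
    IsPullback.of_horiz_isIso ⟨rfl⟩
  have hpt' {X Y : MSCat.{u} (m + 1)} (f : X ⟶ Y) {a b : (classes m).obj ((lev m 0).obj X)}
      {a' b' : (classes m).obj ((lev m 0).obj Y)}
      (ha : (classes m).map ((lev m 0).map f) a = a')
      (hb : (classes m).map ((lev m 0).map f) b = b') :
      𝟙 _ ≫ prod.lift (point m a') (point m b') = prod.lift (point m a) (point m b) ≫
        prod.map ((discretization m).map ((lev m 0).map f))
          ((discretization m).map ((lev m 0).map f)) := by
    rw [Category.id_comp, prod.lift_map, point_comp, point_comp, ha, hb]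
  exact isPullback_of_isPullbacks (isPullback_iff_lev.1 h 1) (isPullback_prodMap h₀ h₀) hpt
    (isPullback_homObj m P hP a b) (isPullback_homObj m X hX a₁ b₁)
    (isPullback_homObj m Y hY a₂ b₂) (isPullback_homObj m Z hZ a₃ b₃)
    (endpoints_naturality m hP hX p).symm (endpoints_naturality m hP hY q).symm
    (hpt' p ha₁ hb₁) (hpt' q ha₂ hb₂) homMapTo_fst homMapTo_fst homMapTo_fst homMapTo_fst
    homMapTo_snd homMapTo_snd homMapTo_snd homMapTo_snd

/-! ### Weakly globular objects, `n`-equivalences and pullbacks -/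

section

variable {m : ℕ} {X : MSCat.{u} (m + 1)} (h : IsWG (m + 1) X)

include h

lemma IsWG.lev (k : ℕ) : IsWG m ((lev m k).obj X) := h.1 k

lemma IsWG.isHomDisc : IsHomDisc m ((WGlob.lev m 0).obj X) := h.2.1.choose

lemma IsWG.isNEquiv (k : ℕ) (hk : 2 ≤ k) :
    IsNEquiv m (inducedSegalMap ((toSimp m).obj X) (gamma m _ h.isHomDisc) k) :=
  h.2.1.choose_spec k hk

lemma IsWG.isSegal : IsSegal ((toSimp m).obj X) := h.2.2.1

lemma IsWG.hasTruncation : HasTruncation m X := h.2.2.2.1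

lemma IsWG.trunc : IsWG m ((WGlob.trunc m).obj X) := h.2.2.2.2

end

lemma IsWG.mk {m : ℕ} {X : MSCat.{u} (m + 1)} (h₁ : ∀ k, IsWG m ((WGlob.lev m k).obj X))
    (h₂ : IsHomDisc m ((WGlob.lev m 0).obj X))
    (h₃ : ∀ k : ℕ, 2 ≤ k → IsNEquiv m (inducedSegalMap ((toSimp m).obj X) (gamma m _ h₂) k))
    (h₄ : IsSegal ((toSimp m).obj X)) (h₅ : HasTruncation m X)
    (h₆ : IsWG m ((WGlob.trunc m).obj X)) : IsWG (m + 1) X :=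
  ⟨h₁, ⟨h₂, h₃⟩, h₄, h₅, h₆⟩

lemma IsNEquiv.mk {m : ℕ} {X Y : MSCat.{u} (m + 1)} {f : X ⟶ Y}
    (hX : IsHomDisc m ((lev m 0).obj X)) (hY : IsHomDisc m ((lev m 0).obj Y))
    (h : ∀ a b, IsNEquiv m (homMap m hX hY f a b)) (h' : IsNEquiv m ((trunc m).map f)) :
    IsNEquiv (m + 1) f := ⟨hX, hY, h, h'⟩

lemma IsNEquiv.homMapTo {m : ℕ} {X Y : MSCat.{u} (m + 1)} {f : X ⟶ Y} (h : IsNEquiv (m + 1) f)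
    (hX : IsHomDisc m ((lev m 0).obj X)) (hY : IsHomDisc m ((lev m 0).obj Y))
    {a b : (classes m).obj ((lev m 0).obj X)} {a' b' : (classes m).obj ((lev m 0).obj Y)}
    (ha : (classes m).map ((lev m 0).map f) a = a')
    (hb : (classes m).map ((lev m 0).map f) b = b') :
    IsNEquiv m (WGlob.homMapTo m hX hY f ha hb) := by
  obtain ⟨hX', hY', h, -⟩ := h
  rw [isNEquiv_homMapTo_iff]
  exact h a b

lemma IsNEquiv.trunc {m : ℕ} {X Y : MSCat.{u} (m + 1)} {f : X ⟶ Y} (h : IsNEquiv (m + 1) f) :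
    IsNEquiv m ((WGlob.trunc m).map f) := h.2.2.2

/-- The stability properties of weakly globular objects and `n`-equivalences, `n = m + 1`, which
are proved by a simultaneous induction: the first property needs the second one for the induced
Segal maps, and the others provide the objects and maps at the discrete corners of the squares. -/
structure Stability (m : ℕ) : Prop where
  /-- Weakly globular objects are stable under pullbacks over structures which come from a
  category. -/
  isWG_of_isPullback {P X Y Z : MSCat.{u} m} {p : P ⟶ X} {q : P ⟶ Y} {f : X ⟶ Z} {g : Y ⟶ Z} :
    IsPullback p q f g → IsWG m X → IsWG m Y → IsCatLike m Z → IsWG m P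
  /-- A map of pullback squares over discrete objects is an `n`-equivalence on pullbacks if it is
  one on the two factors and an isomorphism on the base. -/
  isNEquiv_of_isPullbacks {P X Y Z P' X' Y' Z' : MSCat.{u} m} {p : P ⟶ X} {q : P ⟶ Y} {f : X ⟶ Z}
    {g : Y ⟶ Z} {p' : P' ⟶ X'} {q' : P' ⟶ Y'} {f' : X' ⟶ Z'} {g' : Y' ⟶ Z'} {a : P ⟶ P'}
    {c : X ⟶ X'} {d : Y ⟶ Y'} {e : Z ⟶ Z'} :
    IsPullback p q f g → IsPullback p' q' f' g' → p ≫ c = a ≫ p' → q ≫ d = a ≫ q' →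
    f ≫ e = c ≫ f' → g ≫ e = d ≫ g' → IsWG m X → IsWG m Y → IsDiscr m Z → IsWG m X' →
    IsWG m Y' → IsDiscr m Z' → IsNEquiv m c → IsNEquiv m d → IsIso e → IsNEquiv m a
  /-- Structures which come from a category are weakly globular. -/
  isWG_of_isCatLike {Z : MSCat.{u} m} : IsCatLike m Z → IsWG m Z
  /-- Isomorphisms are `n`-equivalences. -/
  isNEquiv_of_isIso {X Y : MSCat.{u} m} {f : X ⟶ Y} : IsIso f → IsWG m X → IsWG m Y → IsNEquiv m f

lemma isCatEquiv_of_isIso {C D : Cat.{u, u}} (F : C ⟶ D) (h : IsIso F) : IsCatEquiv F :=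
  (Cat.equivOfIso (asIso F)).isEquivalence_functor

lemma isCatEquiv_of_isPullbacks_of_isDiscCat {P X Y Z P' X' Y' Z' : Cat.{u, u}} {p : P ⟶ X}
    {q : P ⟶ Y} {f : X ⟶ Z} {g : Y ⟶ Z} {p' : P' ⟶ X'} {q' : P' ⟶ Y'} {f' : X' ⟶ Z'} {g' : Y' ⟶ Z'}
    {a : P ⟶ P'} {c : X ⟶ X'} {d : Y ⟶ Y'} {e : Z ⟶ Z'}
    (h : IsPullback p q f g) (h' : IsPullback p' q' f' g') (hp : p ≫ c = a ≫ p')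
    (hq : q ≫ d = a ≫ q') (hf : f ≫ e = c ≫ f') (hg : g ≫ e = d ≫ g') (hZ : IsDiscCat Z)
    (hZ' : IsDiscCat Z') (hc : IsCatEquiv c) (hd : IsCatEquiv d) (he : IsIso e) : IsCatEquiv a :=
  have : CategoryTheory.IsDiscrete Z := hZ
  have : CategoryTheory.IsDiscrete Z' := hZ'
  isCatEquiv_of_isPullbacks h h' hp hq hf hg hc hd

lemma stability_zero : Stability.{u} 0 where
  isWG_of_isPullback _ _ _ _ := trivial
  isNEquiv_of_isPullbacks h h' hp hq hf hg _ _ hZ _ _ hZ' hc hd he :=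
    isCatEquiv_of_isPullbacks_of_isDiscCat h h' hp hq hf hg hZ.levDisc hZ'.levDisc hc hd he
  isWG_of_isCatLike _ := trivial
  isNEquiv_of_isIso hf _ _ := isCatEquiv_of_isIso _ hf

/-- Weakly globular objects are stable under isomorphisms, since an object isomorphic to `X` is a
product of `X` with a point. -/
lemma Stability.isWG_of_isIso {m : ℕ} (S : Stability.{u} m) {X Y : MSCat.{u} m} (f : Y ⟶ X)
    (hf : IsIso f) (h : IsWG m X) : IsWG m Y :=
  S.isWG_of_isPullback (Z := (disc m).obj PUnit)
    (IsPullback.of_horiz_isIso ⟨(isTerminalDiscPUnit m).hom_ext _ _⟩ :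
      IsPullback f ((isTerminalDiscPUnit m).from _) ((isTerminalDiscPUnit m).from _) (𝟙 _)) h
    (S.isWG_of_isCatLike (isDiscr_disc m _).isCatLike) (isDiscr_disc m _).isCatLike

lemma Stability.isWG_of_isDiscr {m : ℕ} (S : Stability.{u} m) {X : MSCat.{u} m} (h : IsDiscr m X) :
    IsWG m X := S.isWG_of_isCatLike h.isCatLike

lemma Stability.isWG_homObj {m : ℕ} (S : Stability.{u} m) {X : MSCat.{u} (m + 1)}
    (hX : IsWG (m + 1) X) (h : IsHomDisc m ((lev m 0).obj X))
    (a b : (classes m).obj ((lev m 0).obj X)) : IsWG m (homObj m X h a b) :=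
  S.isWG_of_isPullback (isPullback_homObj m X h a b) (hX.lev 1)
    (S.isWG_of_isDiscr (isDiscr_disc m _))
    (isDiscr_prod (isDiscr_discretization _ _) (isDiscr_discretization _ _)).isCatLike

lemma isDiscr_homObj {m : ℕ} {X : MSCat.{u} (m + 1)}
    (hX : IsDiscr (m + 1) X) (h : IsHomDisc m ((lev m 0).obj X))
    (a b : (classes m).obj ((lev m 0).obj X)) : IsDiscr m (homObj m X h a b) :=
  isDiscr_of_isPullback (isPullback_homObj m X h a b) (hX.lev 1) (isDiscr_disc m _)
    (isDiscr_prod (isDiscr_discretization _ _) (isDiscr_discretization _ _))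

lemma Stability.isWG_fibrePower {m : ℕ} (S : Stability.{u} m) {X : MSCat.{u} (m + 1)}
    (hX : IsWG m ((lev m 1).obj X)) {B : MSCat.{u} m} (hB : IsDiscr m B)
    (γ : (lev m 0).obj X ⟶ B) (k : ℕ) :
    IsWG m (fibrePower ((toSimp m).obj X) γ (k + 1)) := by
  induction k with
  | zero => exact S.isWG_of_isIso _ (isIso_fibrePowerProj_one ((toSimp m).obj X) γ) hX
  | succ k ih =>
    obtain ⟨i, hi⟩ := exists_isPullback_fibrePower ((toSimp m).obj X) γ k
    exact S.isWG_of_isPullback hi ih hX hB.isCatLike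

/-- Objects which come from a category satisfy the induced Segal condition trivially. -/
lemma isIso_inducedSegalMap_gamma {m : ℕ} {Z : MSCat.{u} (m + 1)} (hZ : IsCatLike (m + 1) Z)
    (h : IsHomDisc m ((lev m 0).obj Z)) (k : ℕ) (hk : 2 ≤ k) :
    IsIso (inducedSegalMap ((toSimp m).obj Z) (gamma m _ h) k) := by
  have := isIso_gamma h (hZ.lev 0)
  have hγ : Mono (gamma m _ h) := inferInstance
  exact isIso_inducedSegalMap_of_mono _ (gamma m _ h) hγ k (hZ.isSegal k hk)

lemma isDiscr_fibrePower {m : ℕ} {Z : MSCat.{u} (m + 1)} (hZ : IsCatLike (m + 1) Z)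
    (h : IsHomDisc m ((lev m 0).obj Z)) (k : ℕ) (hk : 2 ≤ k) :
    IsDiscr m (fibrePower ((toSimp m).obj Z) (gamma m _ h) k) := by
  have := isIso_inducedSegalMap_gamma hZ h k hk
  exact (hZ.lev k).of_iso (@asIso (MSCat.{u} m) _ _ _ _ this)

lemma Stability.isWG_of_isPullback_succ {m : ℕ} (S : Stability.{u} m)
    {P X Y Z : MSCat.{u} (m + 1)} {p : P ⟶ X} {q : P ⟶ Y} {f : X ⟶ Z} {g : Y ⟶ Z}
    (h : IsPullback p q f g) (hX : IsWG (m + 1) X) (hY : IsWG (m + 1) Y)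
    (hZ : IsCatLike (m + 1) Z) : IsWG (m + 1) P := by
  have hlev := isPullback_iff_lev.1 h
  have hZ₀ := (hZ.lev 0).isHomDisc
  have hP₀ := isHomDisc_of_isPullback (hlev 0) hX.isHomDisc hY.isHomDisc (hZ.lev 0)
  refine .mk (fun k => S.isWG_of_isPullback (hlev k) (hX.lev k) (hY.lev k) (hZ.lev k).isCatLike)
    hP₀ (fun k hk => ?_) (isSegal_of_isPullback_toSimp h hX.isSegal hY.isSegal hZ.isSegal)
    (hasTruncation_of_isPullback h hZ.levDisc hX.hasTruncation hY.hasTruncation hZ.hasTruncation)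
    (S.isWG_of_isPullback (isPullback_trunc h hZ.levDisc hX.hasTruncation hY.hasTruncation
      hZ.hasTruncation) hX.trunc hY.trunc hZ.trunc)
  obtain ⟨k, rfl⟩ := Nat.exists_eq_add_of_le' hk
  have w {X Y : MSCat.{u} (m + 1)} (f : X ⟶ Y) (hX : IsHomDisc m ((lev m 0).obj X))
      (hY : IsHomDisc m ((lev m 0).obj Y)) :=
    inducedSegalMap_naturality ((toSimp m).map f) (gamma m _ hX) (gamma m _ hY) _
      (gamma_naturality hX hY ((lev m 0).map f)) (k + 2)
  -- The induced Segal map of `P` is the pullback of those of `X` and `Y` over that of `Z`, which is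
  -- an isomorphism.
  exact S.isNEquiv_of_isPullbacks (hlev (k + 2))
    (isPullback_fibrePowerMap (C := MSCat.{u} m) h
      (isPullback_discretization (hlev 0) hX.isHomDisc hY.isHomDisc (hZ.lev 0))
      (gamma_naturality hP₀ hX.isHomDisc ((lev m 0).map p))
      (gamma_naturality hP₀ hY.isHomDisc ((lev m 0).map q))
      (gamma_naturality hX.isHomDisc hZ₀ ((lev m 0).map f))
      (gamma_naturality hY.isHomDisc hZ₀ ((lev m 0).map g)) (k + 2))
    (w p hP₀ hX.isHomDisc) (w q hP₀ hY.isHomDisc) (w f hX.isHomDisc hZ₀) (w g hY.isHomDisc hZ₀)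
    (hX.lev _) (hY.lev _) (hZ.lev _)
    (S.isWG_fibrePower (hX.lev 1) (isDiscr_discretization _ _) _ _)
    (S.isWG_fibrePower (hY.lev 1) (isDiscr_discretization _ _) _ _)
    (isDiscr_fibrePower hZ hZ₀ _ hk) (hX.isNEquiv _ hk) (hY.isNEquiv _ hk)
    (isIso_inducedSegalMap_gamma hZ hZ₀ _ hk)

lemma Stability.isNEquiv_of_isPullbacks_succ {m : ℕ} (S : Stability.{u} m)
    {P X Y Z P' X' Y' Z' : MSCat.{u} (m + 1)} {p : P ⟶ X} {q : P ⟶ Y} {f : X ⟶ Z}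
    {g : Y ⟶ Z} {p' : P' ⟶ X'} {q' : P' ⟶ Y'} {f' : X' ⟶ Z'} {g' : Y' ⟶ Z'} {a : P ⟶ P'}
    {c : X ⟶ X'} {d : Y ⟶ Y'} {e : Z ⟶ Z'}
    (h : IsPullback p q f g) (h' : IsPullback p' q' f' g') (hp : p ≫ c = a ≫ p')
    (hq : q ≫ d = a ≫ q') (hf : f ≫ e = c ≫ f') (hg : g ≫ e = d ≫ g') (hX : IsWG (m + 1) X)
    (hY : IsWG (m + 1) Y) (hZ : IsDiscr (m + 1) Z) (hX' : IsWG (m + 1) X')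
    (hY' : IsWG (m + 1) Y') (hZ' : IsDiscr (m + 1) Z') (hc : IsNEquiv (m + 1) c)
    (hd : IsNEquiv (m + 1) d) (he : IsIso e) : IsNEquiv (m + 1) a := by
  have hZ₀ := (hZ.lev 0).isHomDisc
  have hZ₀' := (hZ'.lev 0).isHomDisc
  have hP₀ := isHomDisc_of_isPullback (isPullback_iff_lev.1 h 0) hX.isHomDisc hY.isHomDisc
    (hZ.lev 0)
  have hP₀' := isHomDisc_of_isPullback (isPullback_iff_lev.1 h' 0) hX'.isHomDisc hY'.isHomDisc
    (hZ'.lev 0)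
  have key {X Y Z : MSCat.{u} (m + 1)} (f : X ⟶ Y) (g : Y ⟶ Z)
      (x : (classes m).obj ((lev m 0).obj X)) :
      (classes m).map ((lev m 0).map g) ((classes m).map ((lev m 0).map f) x) =
        (classes m).map ((lev m 0).map (f ≫ g)) x := by simp
  have sq {P X P' X' : MSCat.{u} (m + 1)} {p : P ⟶ X} {p' : P' ⟶ X'} {a : P ⟶ P'} {c : X ⟶ X'}
      (w : p ≫ c = a ≫ p') (x : (classes m).obj ((lev m 0).obj P)) :
      (classes m).map ((lev m 0).map p') ((classes m).map ((lev m 0).map a) x) =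
        (classes m).map ((lev m 0).map c) ((classes m).map ((lev m 0).map p) x) := by
    rw [key, key, w]
  refine .mk hP₀ hP₀' (fun x y => ?_) (S.isNEquiv_of_isPullbacks
    (isPullback_trunc h hZ.levDisc hX.hasTruncation hY.hasTruncation hZ.hasTruncation)
    (isPullback_trunc h' hZ'.levDisc hX'.hasTruncation hY'.hasTruncation hZ'.hasTruncation)
    (map_square (trunc m) hp) (map_square (trunc m) hq) (map_square (trunc m) hf)
    (map_square (trunc m) hg) hX.trunc hY.trunc hZ.trunc hX'.trunc hY'.trunc hZ'.trunc hc.trunc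
    hd.trunc inferInstance)
  rw [← isNEquiv_homMapTo_iff hP₀ hP₀' a rfl rfl]
  -- The hom objects of `P` and `P'` are pullbacks of those of the factors.
  refine S.isNEquiv_of_isPullbacks
    (isPullback_homMapTo h hP₀ hX.isHomDisc hY.isHomDisc hZ₀ (hZ.lev 0) (a := x) (b := y) rfl rfl
      rfl rfl rfl rfl (sq h.w x) (sq h.w y))
    (isPullback_homMapTo h' hP₀' hX'.isHomDisc hY'.isHomDisc hZ₀' (hZ'.lev 0) rfl rfl rfl rfl rfl
      rfl (sq h'.w _) (sq h'.w _))
    (c := homMapTo m hX.isHomDisc hX'.isHomDisc c (sq hp x).symm (sq hp y).symm)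
    (d := homMapTo m hY.isHomDisc hY'.isHomDisc d (sq hq x).symm (sq hq y).symm)
    (e := homMapTo m hZ₀ hZ₀' e (by rw [sq hp, ← sq hf]) (by rw [sq hp, ← sq hf]))
    ?_ ?_ ?_ ?_ (S.isWG_homObj hX _ _ _) (S.isWG_homObj hY _ _ _) (isDiscr_homObj hZ _ _ _)
    (S.isWG_homObj hX' _ _ _) (S.isWG_homObj hY' _ _ _) (isDiscr_homObj hZ' _ _ _)
    (hc.homMapTo _ _ _ _) (hd.homMapTo _ _ _ _) isIso_homMapTo
  · simp only [homMapTo_comp, hp]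
  · simp only [homMapTo_comp, hq]
  · simp only [homMapTo_comp, hf]
  · simp only [homMapTo_comp, hg]

lemma Stability.isWG_of_isCatLike_succ {m : ℕ} (S : Stability.{u} m)
    {Z : MSCat.{u} (m + 1)} (hZ : IsCatLike (m + 1) Z) : IsWG (m + 1) Z :=
  .mk (fun k => S.isWG_of_isDiscr (hZ.lev k)) (hZ.lev 0).isHomDisc
    (fun k hk => S.isNEquiv_of_isIso (isIso_inducedSegalMap_gamma hZ _ k hk)
      (S.isWG_of_isDiscr (hZ.lev k)) (S.isWG_of_isDiscr (isDiscr_fibrePower hZ _ k hk)))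
    hZ.isSegal hZ.hasTruncation (S.isWG_of_isCatLike hZ.trunc)

lemma Stability.isNEquiv_of_isIso_succ {m : ℕ} (S : Stability.{u} m)
    {X Y : MSCat.{u} (m + 1)} {f : X ⟶ Y} (hf : IsIso f) (hX : IsWG (m + 1) X)
    (hY : IsWG (m + 1) Y) : IsNEquiv (m + 1) f := by
  refine .mk hX.isHomDisc hY.isHomDisc (fun a b => ?_)
    (S.isNEquiv_of_isIso inferInstance hX.trunc hY.trunc)
  rw [← isNEquiv_homMapTo_iff hX.isHomDisc hY.isHomDisc f rfl rfl]
  exact S.isNEquiv_of_isIso isIso_homMapTo (S.isWG_homObj hX _ _ _) (S.isWG_homObj hY _ _ _)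

theorem stability : ∀ m : ℕ, Stability.{u} m
  | 0 => stability_zero
  | m + 1 =>
    have S := stability m
    { isWG_of_isPullback := S.isWG_of_isPullback_succ
      isNEquiv_of_isPullbacks := S.isNEquiv_of_isPullbacks_succ
      isWG_of_isCatLike := S.isWG_of_isCatLike_succ
      isNEquiv_of_isIso := S.isNEquiv_of_isIso_succ }

/-! ### Codiscrete categories -/

/-- The set `A` as the set of objects of the codiscrete category, with exactly one morphism between
any two objects. -/
structure Codisc (A : Type u) : Type u where
  /-- The element underlying an object. -/
  pt : A

instance (A : Type u) : Category.{u} (Codisc A) where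
  Hom _ _ := PUnit.{u + 1}
  id _ := ⟨⟩
  comp _ _ := ⟨⟩

instance (A : Type u) (x y : Codisc A) : Unique (x ⟶ y) := inferInstanceAs (Unique PUnit.{u + 1})

/-- The functor which sends a set to the codiscrete category on it. -/
def codisc : Type u ⥤ Cat.{u, u} where
  obj A := Cat.of (Codisc A)
  map f := Functor.toCatHom { obj := fun x => ⟨f x.pt⟩, map := fun _ => default }

/-- Codiscrete categories are right adjoint to the set of objects. -/
def objectsCodiscAdj : Cat.objects.{u, u} ⊣ codisc.{u} :=
  Adjunction.mkOfHomEquiv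
    { homEquiv := fun C A =>
        { toFun := fun f => Functor.toCatHom { obj := fun x => ⟨f x⟩, map := fun _ => default }
          invFun := fun F => ↾fun x => (F.toFunctor.obj x).pt
          left_inv := fun _ => rfl
          right_inv := fun _ => rfl }
      homEquiv_naturality_left_symm := fun _ _ => rfl
      homEquiv_naturality_right := fun _ _ => rfl }

instance : codisc.{u}.IsRightAdjoint := objectsCodiscAdj.isRightAdjoint

instance isRightAdjoint_catIncl : ∀ m : ℕ, (catIncl.{u} m).IsRightAdjoint
  | 0 => inferInstanceAs (𝟭 Cat.{u, u}).IsRightAdjoint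
  | m + 1 =>
    have : (discLev.{u} m).IsRightAdjoint :=
      isRightAdjoint_whiskeringRight (J := SimplexCategoryᵒᵖ) (disc m)
    have : nerveFunctor.{u, u}.IsRightAdjoint := nerveAdjunction.{u}.isRightAdjoint
    inferInstanceAs (nerveFunctor.{u, u} ⋙ discLev m).IsRightAdjoint

/-- The codiscrete category on a set, as an object of `MSCat m` which is discrete in all directions
but the first. -/
def codiscIncl (m : ℕ) : Type u ⥤ MSCat.{u} m := codisc ⋙ catIncl m

instance (m : ℕ) : (codiscIncl.{u} m).IsRightAdjoint :=
  inferInstanceAs (codisc ⋙ catIncl m).IsRightAdjoint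

lemma isCatLike_codiscIncl (m : ℕ) (A : Type u) : IsCatLike m ((codiscIncl m).obj A) :=
  ⟨_, ⟨Iso.refl _⟩⟩

/-- The truncation of a codiscrete category is the same codiscrete category. -/
def codiscInclCompTrunc (m : ℕ) : codiscIncl.{u} (m + 1) ⋙ trunc m ≅ codiscIncl m :=
  Functor.isoWhiskerLeft codisc (catInclCompTrunc m)

/-- A morphism of a codiscrete category is a pair of objects. -/
lemma isPullback_nerve_codisc (A : Type u) :
    IsPullback ((nerve (Codisc A)).δ (0 : Fin 2)) ((nerve (Codisc A)).δ (1 : Fin 2))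
      (Types.isTerminalPUnit.from _) (Types.isTerminalPUnit.from _) := by
  refine (Types.isPullback_iff _ _ _ _).2 ⟨Types.isTerminalPUnit.hom_ext _ _, ?_, ?_⟩
  · intro x y ⟨h₀, h₁⟩
    have h₀' : x.obj 1 = y.obj 1 := CategoryTheory.Functor.congr_obj h₀ 0
    have h₁' : x.obj 0 = y.obj 0 := CategoryTheory.Functor.congr_obj h₁ 0
    exact ComposableArrows.ext₁ h₁' h₀' (Subsingleton.elim _ _)
  · intro x y _
    refine ⟨ComposableArrows.mk₁ (default : y.obj 0 ⟶ x.obj 0), ?_, ?_⟩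
    · exact ComposableArrows.ext₀ rfl
    · exact ComposableArrows.ext₀ rfl

/-- The hom objects of a codiscrete category are points, as `X₁ ⟶ X₀ × X₀` is an isomorphism. -/
lemma isIso_endpoints_codiscIncl (m : ℕ) (A : Type u)
    (h : IsHomDisc m ((lev m 0).obj ((codiscIncl (m + 1)).obj A))) :
    IsIso (endpoints m _ h) := by
  have hγ : IsIso (gamma m _ h) := isIso_gamma h ((isCatLike_codiscIncl (m + 1) A).lev 0)
  have h₁ : IsPullback ((face m 0).app ((codiscIncl (m + 1)).obj A))
      ((face m 1).app ((codiscIncl (m + 1)).obj A)) _ _ := (isPullback_nerve_codisc A).map (disc m)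
  have h₂ := IsPullback.of_is_product'
    (prodIsProd ((discretization m).obj ((lev m 0).obj ((codiscIncl (m + 1)).obj A)))
      ((discretization m).obj ((lev m 0).obj ((codiscIncl (m + 1)).obj A)))) (isTerminalDiscPUnit m)
  refine isIso_of_isPullbacks h₁ h₂ (f₁ := gamma m _ h) (f₂ := gamma m _ h) (f₃ := 𝟙 _) ?_ ?_ ?_ ?_
  · exact (prod.lift_fst _ _).symm
  · exact (prod.lift_snd _ _).symm
  · exact (isTerminalDiscPUnit m).hom_ext _ _
  · exact (isTerminalDiscPUnit m).hom_ext _ _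

lemma isIso_homMapTo_codiscIncl (m : ℕ) {A B : Type u} (φ : A ⟶ B)
    (hA : IsHomDisc m ((lev m 0).obj ((codiscIncl (m + 1)).obj A)))
    (hB : IsHomDisc m ((lev m 0).obj ((codiscIncl (m + 1)).obj B)))
    {a b : (classes m).obj ((lev m 0).obj ((codiscIncl (m + 1)).obj A))}
    {a' b' : (classes m).obj ((lev m 0).obj ((codiscIncl (m + 1)).obj B))}
    (ha : (classes m).map ((lev m 0).map ((codiscIncl (m + 1)).map φ)) a = a')
    (hb : (classes m).map ((lev m 0).map ((codiscIncl (m + 1)).map φ)) b = b') :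
    IsIso (homMapTo m hA hB ((codiscIncl (m + 1)).map φ) ha hb) := by
  have := isIso_endpoints_codiscIncl m A hA
  have := isIso_endpoints_codiscIncl m B hB
  have := (isPullback_homObj m _ hA a b).isIso_snd_of_isIso
  have := (isPullback_homObj m _ hB a' b').isIso_snd_of_isIso
  have h := homMapTo_snd (hX := hA) (hY := hB) (ha := ha) (hb := hb)
  rw [Category.comp_id] at h
  exact IsIso.of_isIso_fac_right h

lemma isCatEquiv_fst_of_isPullback_codisc {P X : Cat.{u, u}} {A B : Type u} {φ : A ⟶ B}
    {p : P ⟶ X} {q : P ⟶ codisc.obj A} {f : X ⟶ codisc.obj B}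
    (h : IsPullback p q f (codisc.map φ)) (hφ : Function.Surjective φ) : IsCatEquiv p :=
  have : Quiver.IsThin (codisc.obj B) := fun _ _ => inferInstanceAs (Subsingleton PUnit)
  isCatEquiv_fst_of_isPullback h
    { preimage := fun _ => (default : PUnit)
      map_preimage := fun _ => rfl
      preimage_map := fun _ => rfl }
    (fun ⟨y⟩ => let ⟨x, hx⟩ := hφ y; ⟨⟨x⟩, congrArg Codisc.mk hx⟩)

/-- The base change of a surjection of codiscrete categories along a map from a weakly globular
object is an `n`-equivalence: it is an isomorphism on hom objects, and its truncation is again such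
a base change. -/
theorem isNEquiv_fst_of_isPullback_codiscIncl : ∀ {m : ℕ} {P X : MSCat.{u} m} {A B : Type u}
    {φ : A ⟶ B} {p : P ⟶ X} {q : P ⟶ (codiscIncl m).obj A} {f : X ⟶ (codiscIncl m).obj B},
    IsPullback p q f ((codiscIncl m).map φ) → Function.Surjective φ → IsWG m X → IsNEquiv m p
  | 0, _, _, _, _, _, _, _, _, h, hφ, _ => isCatEquiv_fst_of_isPullback_codisc h hφ
  | m + 1, P, X, A, B, φ, p, q, f, h, hφ, hX => by
    have hA := isCatLike_codiscIncl (m + 1) A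
    have hB := isCatLike_codiscIncl (m + 1) B
    have S := stability.{u} m
    have hP := (stability.{u} (m + 1)).isWG_of_isPullback h hX
      ((stability.{u} (m + 1)).isWG_of_isCatLike hA) hB
    have hA₀ := (hA.lev 0).isHomDisc
    have hB₀ := (hB.lev 0).isHomDisc
    refine .mk hP.isHomDisc hX.isHomDisc (fun a b => ?_) ?_
    · rw [← isNEquiv_homMapTo_iff hP.isHomDisc hX.isHomDisc p rfl rfl]
      have w (x : (classes m).obj ((lev m 0).obj P)) :
          (classes m).map ((lev m 0).map f) ((classes m).map ((lev m 0).map p) x) =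
            (classes m).map ((lev m 0).map ((codiscIncl (m + 1)).map φ))
              ((classes m).map ((lev m 0).map q) x) := by
        have := congr((classes m).map ((lev m 0).map $(h.w)) x)
        simpa using this
      have := isIso_homMapTo_codiscIncl m φ hA₀ hB₀ (w a).symm (w b).symm
      have h' := isPullback_homMapTo h hP.isHomDisc hX.isHomDisc hA₀ hB₀ (hB.lev 0)
        (a := a) (b := b) rfl rfl rfl rfl rfl rfl (w a).symm (w b).symm
      exact S.isNEquiv_of_isIso h'.isIso_fst_of_isIso (S.isWG_homObj hP _ _ _)
        (S.isWG_homObj hX _ _ _)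
    · have h' := isPullback_trunc h hB.levDisc hX.hasTruncation hA.hasTruncation hB.hasTruncation
      have h'' : IsPullback ((trunc m).map p)
          ((trunc m).map q ≫ ((codiscInclCompTrunc m).app A).hom)
          ((trunc m).map f ≫ ((codiscInclCompTrunc m).app B).hom) ((codiscIncl m).map φ) :=
        h'.of_iso (Iso.refl _) (Iso.refl _) ((codiscInclCompTrunc m).app A)
          ((codiscInclCompTrunc m).app B) (by simp) (by simp) (by simp)
          ((codiscInclCompTrunc m).hom.naturality φ)
      exact isNEquiv_fst_of_isPullback_codiscIncl h'' hφ hX.trunc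

/-! ### Maps to codiscrete categories -/

/-- The nerve of the codiscrete category on a set. -/
def nerveCodisc : Type u ⥤ SSet.{u} := codisc ⋙ nerveFunctor.{u, u}

/-- The objects of the codiscrete category on `A`, as vertices of its nerve. -/
def nerveCodiscZero (A : Type u) : A ≅ (nerveCodisc.obj A).obj (op (SimplexCategory.mk 0)) :=
  Equiv.toIso
    { toFun := fun a => ComposableArrows.mk₀ (Codisc.mk a)
      invFun := fun x => (ComposableArrows.obj' (C := Codisc A) x 0).pt
      left_inv := fun _ => rfl
      right_inv := fun _ => ComposableArrows.ext₀ rfl }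

/-- The `i`-th vertex of a simplex of the nerve of a codiscrete category. -/
def nerveCodiscVertex {A : Type u} {k : SimplexCategoryᵒᵖ} (x : (nerveCodisc.obj A).obj k)
    (i : Fin (k.unop.len + 1)) : A :=
  (Prefunctor.obj (V := Fin (k.unop.len + 1)) (W := Codisc A)
    (CategoryTheory.Functor.toPrefunctor x) i).pt

lemma nerveCodisc_ext {A : Type u} {k : SimplexCategoryᵒᵖ} {x y : (nerveCodisc.obj A).obj k}
    (h : ∀ i, nerveCodiscVertex x i = nerveCodiscVertex y i) : x = y :=
  CategoryTheory.Functor.ext (fun i => congrArg Codisc.mk (h i))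
    (fun _ _ _ => rfl)

/-- The simplicial map to the nerve of a codiscrete category with given values on vertices. -/
def toNerveCodisc (T : SSet.{u}) {A : Type u} (f : T.obj (op (SimplexCategory.mk 0)) ⟶ A) :
    T ⟶ nerveCodisc.obj A where
  app k := ↾fun t =>
    ({ obj := fun i => ⟨f (T.map (SimplexCategory.const (SimplexCategory.mk 0) k.unop i).op t)⟩
       map := fun _ => default } : ComposableArrows (Codisc A) k.unop.len)
  naturality k l g := ConcreteCategory.hom_ext _ _ fun t => nerveCodisc_ext fun i => by
    refine congrArg f ?_
    change (T.map g ≫ T.map _) t = T.map _ t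
    rw [← T.map_comp]
    rfl

/-- A simplicial map to the nerve of a codiscrete category is determined by its values on
vertices. -/
lemma nerveCodisc_hom_ext {T : SSet.{u}} {A : Type u} {a b : T ⟶ nerveCodisc.obj A}
    (h : a.app (op (SimplexCategory.mk 0)) = b.app (op (SimplexCategory.mk 0))) : a = b := by
  have key (c : T ⟶ nerveCodisc.obj A) (k : SimplexCategoryᵒᵖ) (t : T.obj k)
      (i : Fin (k.unop.len + 1)) : nerveCodiscVertex (c.app k t) i =
        nerveCodiscVertex (c.app (op (SimplexCategory.mk 0))
          (T.map (SimplexCategory.const (SimplexCategory.mk 0) k.unop i).op t)) 0 := by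
    have := congr($(c.naturality (SimplexCategory.const (SimplexCategory.mk 0) k.unop i).op) t)
    exact congr(nerveCodiscVertex $this 0).symm
  refine NatTrans.ext (funext fun k => ConcreteCategory.hom_ext _ _ fun t =>
    nerveCodisc_ext fun i => ?_)
  rw [key a, key b, h]

lemma toNerveCodisc_app_zero (T : SSet.{u}) {A : Type u}
    (f : T.obj (op (SimplexCategory.mk 0)) ⟶ A) :
    (toNerveCodisc T f).app (op (SimplexCategory.mk 0)) = f ≫ (nerveCodiscZero A).hom := by
  refine ConcreteCategory.hom_ext _ _ fun t => nerveCodisc_ext fun i => congrArg f ?_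
  have : SimplexCategory.const (SimplexCategory.mk 0) (SimplexCategory.mk 0) i = 𝟙 _ :=
    SimplexCategory.isTerminalZero.hom_ext _ _
  change T.map (SimplexCategory.const (SimplexCategory.mk 0) (SimplexCategory.mk 0) i).op t = t
  rw [this]
  simp

lemma nerveCodiscZero_naturality {A B : Type u} (φ : A ⟶ B) :
    φ ≫ (nerveCodiscZero B).hom = (nerveCodiscZero A).hom ≫
      (nerveCodisc.map φ).app (op (SimplexCategory.mk 0)) :=
  ConcreteCategory.hom_ext _ _ fun _ => nerveCodisc_ext fun _ => rfl

section

variable {D : Type*} [Category* D] {L : D ⥤ Type u} {G : Type u ⥤ D} (adj : L ⊣ G)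
  {X : SimplexCategoryᵒᵖ ⥤ D} {A : Type u}

/-- An adjunction applied levelwise. -/
def levelwiseHomEquiv (X : SimplexCategoryᵒᵖ ⥤ D) (S : SSet.{u}) :
    (X ⋙ L ⟶ S) ≃ (X ⟶ S ⋙ G) where
  toFun t :=
    { app := fun k => adj.homEquiv _ _ (t.app k)
      naturality := fun k l g => by
        rw [← adj.homEquiv_naturality_left, Functor.comp_map, ← adj.homEquiv_naturality_right,
          ← t.naturality, Functor.comp_map] }
  invFun t :=
    { app := fun k => (adj.homEquiv _ _).symm (t.app k)
      naturality := fun k l g => by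
        rw [Functor.comp_map, ← adj.homEquiv_naturality_left_symm,
          ← adj.homEquiv_naturality_right_symm, t.naturality, Functor.comp_map] }
  left_inv t := by ext : 2; simp
  right_inv t := by ext : 2; simp

/-- For a right adjoint functor `G`, the map from `X` to the codiscrete simplicial object on `G A`
with a given component `X₀ ⟶ G A`. -/
def toCodiscLev (f : X.obj (op (SimplexCategory.mk 0)) ⟶ G.obj A) :
    X ⟶ nerveCodisc.obj A ⋙ G :=
  levelwiseHomEquiv adj X _ (toNerveCodisc (X ⋙ L) ((adj.homEquiv _ A).symm f))

lemma toCodiscLev_app_zero (f : X.obj (op (SimplexCategory.mk 0)) ⟶ G.obj A) :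
    (toCodiscLev adj f).app (op (SimplexCategory.mk 0)) = f ≫ G.map (nerveCodiscZero A).hom := by
  obtain ⟨f, rfl⟩ := (adj.homEquiv _ A).surjective f
  rw [← adj.homEquiv_naturality_right, toCodiscLev, Equiv.symm_apply_apply]
  exact congrArg (adj.homEquiv _ _) (toNerveCodisc_app_zero (X ⋙ L) f)

include adj in
lemma codiscLev_hom_ext {a b : X ⟶ nerveCodisc.obj A ⋙ G}
    (h : a.app (op (SimplexCategory.mk 0)) = b.app (op (SimplexCategory.mk 0))) : a = b :=
  (levelwiseHomEquiv adj X _).symm.injective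
    (nerveCodisc_hom_ext (congrArg (adj.homEquiv _ _).symm h))

lemma toCodiscLev_naturality {Y : SimplexCategoryᵒᵖ ⥤ D} {B : Type u}
    {f : X.obj (op (SimplexCategory.mk 0)) ⟶ G.obj A}
    {f' : Y.obj (op (SimplexCategory.mk 0)) ⟶ G.obj B} (g : X ⟶ Y)
    (φ : A ⟶ B) (w : g.app _ ≫ f' = f ≫ G.map φ) :
    g ≫ toCodiscLev adj f' =
      toCodiscLev adj f ≫ Functor.whiskerRight (nerveCodisc.map φ) G := by
  apply codiscLev_hom_ext adj
  rw [NatTrans.comp_app, NatTrans.comp_app, toCodiscLev_app_zero, toCodiscLev_app_zero]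
  have h := G.congr_map (nerveCodiscZero_naturality φ)
  rw [G.map_comp, G.map_comp] at h
  exact ((Category.assoc _ _ _).symm.trans (w =≫ _)).trans ((Category.assoc _ _ _).trans
    ((f ≫= h).trans (Category.assoc _ _ _).symm))

end

/-! ### The replacement -/

lemma paste_two_squares {C : Type*} [Category* C] {X₁ X₂ X₃ Y₁ Y₂ Y₃ : C} {a₁ : X₁ ⟶ X₂}
    {a₂ : X₂ ⟶ X₃} {b₁ : Y₁ ⟶ Y₂} {b₂ : Y₂ ⟶ Y₃} {f₁ : X₁ ⟶ Y₁} {f₂ : X₂ ⟶ Y₂} {f₃ : X₃ ⟶ Y₃}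
    (h₁ : f₁ ≫ b₁ = a₁ ≫ f₂) (h₂ : f₂ ≫ b₂ = a₂ ≫ f₃) : f₁ ≫ b₁ ≫ b₂ = (a₁ ≫ a₂) ≫ f₃ := by
  rw [reassoc_of% h₁, h₂, Category.assoc]

lemma inv_square {C : Type*} [Category* C] {X₁ X₂ Y₁ Y₂ : C} {a : X₁ ⟶ X₂} {b : Y₁ ⟶ Y₂}
    [IsIso a] [IsIso b] {f : X₁ ⟶ Y₁} {g : X₂ ⟶ Y₂} (h : f ≫ b = a ≫ g) :
    g ≫ inv b = inv a ≫ f := by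
  rw [IsIso.comp_inv_eq, Category.assoc, h, IsIso.inv_hom_id_assoc]

lemma counit_comp_eq_map {C D : Type*} [Category* C] [Category* D] {L : C ⥤ D} {R : D ⥤ C}
    (adj : L ⊣ R) {A : C} {Y : D} (γ : Y ⟶ L.obj A) [IsIso (adj.unit.app A)] :
    adj.counit.app Y ≫ γ = L.map (R.map γ ≫ inv (adj.unit.app A)) := by
  have h : inv (L.map (adj.unit.app A)) = adj.counit.app (L.obj A) :=
    IsIso.inv_eq_of_hom_inv_id (adj.left_triangle_components A)
  rw [L.map_comp, Functor.map_inv, h]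
  exact (adj.counit.naturality γ).symm

/-- The set `U` of objects of `(X₀)_{0⋯0}`. -/
def objFun (m : ℕ) : CatWG.{u} (m + 1) ⥤ Type u := levZero m ⋙ objSet m

/-- The set underlying `X₀^d`. -/
def clsFun (m : ℕ) : CatWG.{u} (m + 1) ⥤ Type u := levZero m ⋙ classes m

/-- The discretization maps `X₀ ⟶ X₀^d`. -/
def gammaZero (m : ℕ) : levZero.{u} m ⟶ clsFun m ⋙ disc m where
  app X := gamma m _ (isHomDisc_levZero m X)
  naturality _ _ f := gamma_naturality _ _ ((levZero m).map f)

/-- The map from an object of `X₀` to its class in `X₀^d`. -/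
def objToCls (m : ℕ) : objFun.{u} m ⟶ clsFun m where
  app X := (objSet m).map ((gammaZero m).app X) ≫ inv ((discAdj m).unit.app ((clsFun m).obj X))
  naturality X Y f := by
    have h := map_square (objSet m) ((gammaZero m).naturality f)
    have h' := inv_square ((discAdj m).unit.naturality ((clsFun m).map f))
    exact paste_two_squares h h'

/-- The map from `X` to the codiscrete category on `X₀^d`. -/
def toCodiscCls (m : ℕ) : (IsWG.{u} (m + 1)).ι ⟶ clsFun m ⋙ codiscIncl (m + 1) where
  app X := toCodiscLev (Adjunction.ofIsRightAdjoint (disc m)) (X := (toSimp m).obj X.obj)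
    ((gammaZero m).app X)
  naturality _ _ f := toCodiscLev_naturality (Adjunction.ofIsRightAdjoint (disc m))
    ((toSimp m).map f.hom) ((clsFun m).map f) ((gammaZero m).naturality f)

lemma objToCls_surjective {m : ℕ} (X : CatWG.{u} (m + 1)) :
    Function.Surjective ((objToCls m).app X) := by
  have h := objSet_gamma_surjective (isHomDisc_levZero m X)
  have h' : Function.Surjective (inv ((discAdj m).unit.app ((clsFun m).obj X))) :=
    ((isIso_iff_bijective _).1 inferInstance).2
  exact h'.comp h

lemma isIso_objToCls {m : ℕ} {X : CatWG.{u} (m + 1)} (h : IsDiscr (m + 1) X.obj) :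
    IsIso ((objToCls m).app X) := by
  have : IsIso ((gammaZero m).app X) := isIso_gamma _ (h.lev 0)
  exact IsIso.comp_isIso' (isIso_map_of_isIso (objSet m) this) inferInstance

/-- The counit of `discAdj` picks the objects of `X₀`, so it covers `objToCls` along the
discretization map. -/
lemma counit_gammaZero {m : ℕ} (X : CatWG.{u} (m + 1)) :
    (discAdj m).counit.app ((levZero m).obj X) ≫ (gammaZero m).app X =
      (disc m).map ((objToCls m).app X) := by
  exact counit_comp_eq_map (discAdj m) ((gammaZero m).app X)

/-- The functor `X ↦ X ×_{C(X₀^d)} C(U)`, where `C` denotes codiscrete categories and `U` is the set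
of objects of `X₀`, with values in `MSCat (m + 1)`. -/
def replacementObj (m : ℕ) : CatWG.{u} (m + 1) ⥤ MSCat.{u} (m + 1) :=
  pullback (toCodiscCls.{u} m) (Functor.whiskerRight (objToCls.{u} m) (codiscIncl (m + 1)))

/-- The projection from the replacement of `X` to `X`. -/
def replacementFst (m : ℕ) : replacementObj.{u} m ⟶ (IsWG.{u} (m + 1)).ι :=
  pullback.fst (toCodiscCls.{u} m) (Functor.whiskerRight (objToCls.{u} m) (codiscIncl (m + 1)))

/-- The projection from the replacement of `X` to the codiscrete category on the objects of `X₀`. -/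
def replacementSnd (m : ℕ) : replacementObj.{u} m ⟶ objFun m ⋙ codiscIncl (m + 1) :=
  pullback.snd (toCodiscCls.{u} m) (Functor.whiskerRight (objToCls.{u} m) (codiscIncl (m + 1)))

lemma isPullback_replacement {m : ℕ} (X : CatWG.{u} (m + 1)) :
    IsPullback ((replacementFst m).app X) ((replacementSnd m).app X) ((toCodiscCls m).app X)
      ((codiscIncl (m + 1)).map ((objToCls m).app X)) :=
  (IsPullback.of_hasPullback (toCodiscCls.{u} m)
    (Functor.whiskerRight (objToCls.{u} m) (codiscIncl (m + 1)))).app X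

lemma isWG_replacement {m : ℕ} (X : CatWG.{u} (m + 1)) : IsWG (m + 1) ((replacementObj m).obj X) :=
  (stability (m + 1)).isWG_of_isPullback (isPullback_replacement X) X.property
    ((stability (m + 1)).isWG_of_isCatLike (isCatLike_codiscIncl _ _)) (isCatLike_codiscIncl _ _)

/-- A functor `F` with natural maps `V : F X ⟶ X` and `W` from `F X` to the codiscrete category
`C(U)` on the objects of `X₀`, which exhibit `F X` as the pullback `X ×_{C(X₀^d)} C(U)`. -/
structure Replacement (m : ℕ) where
  /-- The functor `F`. -/
  F : CatWG.{u} (m + 1) ⥤ CatWG.{u} (m + 1)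
  /-- The natural map `F X ⟶ X`. -/
  V : F ⟶ 𝟭 (CatWG.{u} (m + 1))
  /-- The natural map from `F X` to the codiscrete category on the objects of `X₀`. -/
  W : F ⋙ (IsWG.{u} (m + 1)).ι ⟶ objFun m ⋙ codiscIncl (m + 1)
  isPullback (X : CatWG.{u} (m + 1)) : IsPullback (V.app X).hom (W.app X) ((toCodiscCls m).app X)
    ((codiscIncl (m + 1)).map ((objToCls m).app X))

/-- The chosen pullbacks are a replacement. -/
def canonicalReplacement (m : ℕ) : Replacement.{u} m where
  F := (IsWG.{u} (m + 1)).lift (replacementObj m) isWG_replacement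
  V :=
    { app := fun X => ObjectProperty.homMk ((replacementFst m).app X)
      naturality := fun _ _ f => ObjectProperty.hom_ext _ ((replacementFst m).naturality f) }
  W := replacementSnd m
  isPullback := isPullback_replacement

/-- The replacements of the objects may be changed along isomorphisms. -/
def Replacement.copyObj {m : ℕ} (R : Replacement.{u} m)
    (obj : CatWG.{u} (m + 1) → CatWG.{u} (m + 1)) (e : ∀ X, R.F.obj X ≅ obj X) :
    Replacement.{u} m where
  F := R.F.copyObj obj e
  V := (R.F.isoCopyObj obj e).inv ≫ R.V
  W := Functor.whiskerRight (R.F.isoCopyObj obj e).inv _ ≫ R.W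
  isPullback X := (R.isPullback X).of_iso ((IsWG.{u} (m + 1)).ι.mapIso (e X)) (Iso.refl _)
    (Iso.refl _) (Iso.refl _) (by rw [Iso.refl_hom, Category.comp_id, ← Iso.inv_comp_eq]; rfl)
    (by rw [Iso.refl_hom, Category.comp_id, ← Iso.inv_comp_eq]; rfl) (by simp) (by simp)

namespace Replacement

variable {m : ℕ} (R : Replacement.{u} m)

lemma isNEquiv (X : CatWG.{u} (m + 1)) : IsNEquiv (m + 1) (R.V.app X).hom :=
  isNEquiv_fst_of_isPullback_codiscIncl (R.isPullback X) (objToCls_surjective X) X.property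

lemma isIso_of_isDiscr {X : CatWG.{u} (m + 1)} (h : IsDiscr (m + 1) X.obj) :
    IsIso (R.V.app X) := by
  have := isIso_objToCls h
  have : IsIso ((codiscIncl (m + 1)).map ((objToCls m).app X)) := inferInstance
  have : IsIso ((IsWG.{u} (m + 1)).ι.map (R.V.app X)) := (R.isPullback X).isIso_fst_of_isIso
  exact isIso_of_reflects_iso (R.V.app X) (IsWG.{u} (m + 1)).ι

/-- A replacement is isomorphic to one which is strictly the identity on discrete objects. -/
lemma exists_normalized : ∃ R : Replacement.{u} m, ∀ X, IsDiscr (m + 1) X.obj →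
    ∃ h : R.F.obj X = X, R.V.app X = eqToHom h := by
  let R := canonicalReplacement.{u} m
  have key (X : CatWG.{u} (m + 1)) : ∃ (Y : CatWG.{u} (m + 1)) (e : R.F.obj X ≅ Y),
      IsDiscr (m + 1) X.obj → ∃ h : Y = X, e.inv ≫ R.V.app X = eqToHom h := by
    by_cases hX : IsDiscr (m + 1) X.obj
    · have := R.isIso_of_isDiscr hX
      exact ⟨X, asIso (R.V.app X), fun _ => ⟨rfl, by simp⟩⟩
    · exact ⟨R.F.obj X, Iso.refl _, fun h => absurd h hX⟩
  choose obj e he using key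
  exact ⟨R.copyObj obj e, he⟩

end Replacement

/-! ### Discrete objects -/

/-- The multinerve of a discrete object is constant. -/
def discCompMultinerve : ∀ m : ℕ, disc.{u} m ⋙ multinerve m ≅ constSet (m + 1)
  | 0 => typeToCatCompNerve
  | m + 1 =>
    Functor.isoWhiskerRight (discSuccIso m) (multinerve (m + 1)) ≪≫
      Functor.isoWhiskerLeft (disc m) (constCompWhiskering (multinerve m)) ≪≫
        Functor.isoWhiskerRight (discCompMultinerve m)
          (SimplicialObject.const (MSSet.{u} (m + 1)))

lemma IsDiscreteObj.isDiscr {m : ℕ} {X : MSCat.{u} m} (h : IsDiscreteObj m X) : IsDiscr m X :=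
  let ⟨A, ⟨e⟩⟩ := h
  ⟨A, ⟨(multinerveFullyFaithful m).preimageIso (e ≪≫ (discCompMultinerve m).symm.app A)⟩⟩

namespace Replacement

variable {m : ℕ} (R : Replacement.{u} m)

/-! ### Pullbacks over discrete objects -/

lemma isPullback_of_map_ι {P X Y Z : CatWG.{u} (m + 1)} {p : P ⟶ X} {q : P ⟶ Y} {f : X ⟶ Z}
    {g : Y ⟶ Z} (h : IsPullback p.hom q.hom f.hom g.hom) : IsPullback p q f g :=
  IsPullback.of_map (IsWG.{u} (m + 1)).ι (ObjectProperty.hom_ext _ h.w) h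

/-- Pullbacks over discrete objects are preserved: `F` is built from a pullback, and from functors
which preserve such pullbacks. -/
lemma isPullback_map {P X Y Z : CatWG.{u} (m + 1)} {p : P ⟶ X} {q : P ⟶ Y} {f : X ⟶ Z}
    {g : Y ⟶ Z} (h : IsPullback p.hom q.hom f.hom g.hom) (hZ : IsDiscr (m + 1) Z.obj) :
    IsPullback (R.F.map p) (R.F.map q) (R.F.map f) (R.F.map g) := by
  have h₀ := isPullback_iff_lev.1 h 0
  have hU : IsPullback ((objFun m).map p) ((objFun m).map q) ((objFun m).map f)
      ((objFun m).map g) := h₀.map (objSet m)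
  have hA : IsPullback ((clsFun m).map p) ((clsFun m).map q) ((clsFun m).map f)
      ((clsFun m).map g) :=
    isPullback_classes h₀ (isHomDisc_levZero m X) (isHomDisc_levZero m Y) (hZ.lev 0)
  have hφ {X Y : CatWG.{u} (m + 1)} (f : X ⟶ Y) :=
    map_square (codiscIncl (m + 1)) ((objToCls m).naturality f)
  have hV {X Y : CatWG.{u} (m + 1)} (f : X ⟶ Y) :
      (R.F.map f).hom ≫ (R.V.app Y).hom = (R.V.app X).hom ≫ f.hom :=
    congrArg (·.hom) (R.V.naturality f)
  exact isPullback_of_map_ι (isPullback_of_isPullbacks h (hA.map (codiscIncl (m + 1)))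
    (hU.map (codiscIncl (m + 1))) (R.isPullback P) (R.isPullback X) (R.isPullback Y)
    (R.isPullback Z) ((toCodiscCls m).naturality p) ((toCodiscCls m).naturality q) (hφ p) (hφ q)
    (hV p) (hV q) (hV f) (hV g) (R.W.naturality p) (R.W.naturality q) (R.W.naturality f)
    (R.W.naturality g))

lemma preservesLimit_cospan {X Y Z : CatWG.{u} (m + 1)} (f : X ⟶ Z) (g : Y ⟶ Z)
    (hZ : IsDiscr (m + 1) Z.obj) : PreservesLimit (cospan f g) R.F := by
  have h := IsPullback.of_hasPullback f.hom g.hom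
  let P : CatWG.{u} (m + 1) := ⟨pullback f.hom g.hom,
    (stability (m + 1)).isWG_of_isPullback h X.property Y.property hZ.isCatLike⟩
  let p : P ⟶ X := ObjectProperty.homMk (pullback.fst f.hom g.hom)
  let q : P ⟶ Y := ObjectProperty.homMk (pullback.snd f.hom g.hom)
  have h₁ : IsPullback p q f g := isPullback_of_map_ι h
  have h₂ := R.isPullback_map (p := p) (q := q) h hZ
  exact preservesLimit_of_preserves_limit_cone h₁.isLimit
    ((isLimitMapConePullbackConeEquiv R.F h₁.w).symm h₂.isLimit)

/-! ### Sections of the discretization map -/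

/-- The map from `(F X)₀` to the set of objects of `X₀`. -/
def toObj (X : CatWG.{u} (m + 1)) :
    (levZero m).obj (R.F.obj X) ⟶ (disc m).obj ((objFun m).obj X) :=
  (lev m 0).map (R.W.app X) ≫ (disc m).map (nerveCodiscZero ((objFun m).obj X)).inv

/-- In degree `0` the replacement is the pullback `X₀ ×_A U` over the set `A` of classes, where `U`
is the set of objects of `X₀`. -/
lemma isPullback_toObj (X : CatWG.{u} (m + 1)) :
    IsPullback ((levZero m).map (R.V.app X)) (R.toObj X) ((gammaZero m).app X)
      ((disc m).map ((objToCls m).app X)) := by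
  refine (isPullback_iff_lev.1 (R.isPullback X) 0).of_iso (Iso.refl _) (Iso.refl _)
    ((disc m).mapIso (nerveCodiscZero ((objFun m).obj X)).symm)
    ((disc m).mapIso (nerveCodiscZero ((clsFun m).obj X)).symm) ?_ ?_ ?_ ?_
  · exact (Category.comp_id _).trans (Category.id_comp _).symm
  · exact (Category.id_comp (R.toObj X)).symm
  · refine Eq.trans ?_ (Category.id_comp ((gammaZero m).app X)).symm
    refine (toCodiscLev_app_zero (Adjunction.ofIsRightAdjoint (disc m))
      (X := (toSimp m).obj X.obj) ((gammaZero m).app X) =≫ _).trans ?_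
    exact (Category.assoc _ _ _).trans ((_ ≫= Iso.hom_inv_id
      ((disc m).mapIso (nerveCodiscZero ((clsFun m).obj X)))).trans (Category.comp_id _))
  · have h : (nerveCodisc.map ((objToCls m).app X)).app (op (SimplexCategory.mk 0)) ≫
        (nerveCodiscZero _).inv = (nerveCodiscZero _).inv ≫ (objToCls m).app X := by
      rw [Iso.comp_inv_eq, Category.assoc, nerveCodiscZero_naturality, Iso.inv_hom_id_assoc]
    exact map_square (disc m) h

lemma toObj_naturality {X Y : CatWG.{u} (m + 1)} (f : X ⟶ Y) :
    (levZero m).map (R.F.map f) ≫ R.toObj Y = R.toObj X ≫ (disc m).map ((objFun m).map f) := by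
  have h : (nerveCodisc.map ((objFun m).map f)).app (op (SimplexCategory.mk 0)) ≫
      (nerveCodiscZero _).inv = (nerveCodiscZero _).inv ≫ (objFun m).map f := by
    rw [Iso.comp_inv_eq, Category.assoc, nerveCodiscZero_naturality, Iso.inv_hom_id_assoc]
  exact paste_two_squares (map_square (lev m 0) (R.W.naturality f)) (map_square (disc m) h)

/-- The classes of `(F X)₀` are the objects of `X₀`. -/
lemma isIso_classes_toObj (X : CatWG.{u} (m + 1)) : IsIso ((classes m).map (R.toObj X)) := by
  have h := isPullback_classes (R.isPullback_toObj X) (isHomDisc_levZero m X)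
    (isDiscr_disc m _).isHomDisc (isDiscr_disc m _)
  have : IsIso ((classes m).map ((gammaZero m).app X)) := isIso_classes_gamma _
  exact h.isIso_snd_of_isIso

/-- Each object `x` of `X₀` determines the object `(x, x)` of `(F X)₀ = X₀ ×_A U`. -/
def ofObj (X : CatWG.{u} (m + 1)) :
    (disc m).obj ((objFun m).obj X) ⟶ (levZero m).obj (R.F.obj X) :=
  (R.isPullback_toObj X).lift ((discAdj m).counit.app ((levZero m).obj X)) (𝟙 _)
    ((counit_gammaZero X).trans (Category.id_comp _).symm)

lemma ofObj_fst (X : CatWG.{u} (m + 1)) : R.ofObj X ≫ (levZero m).map (R.V.app X) =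
    (discAdj m).counit.app ((levZero m).obj X) :=
  (R.isPullback_toObj X).lift_fst _ _ _

lemma ofObj_toObj (X : CatWG.{u} (m + 1)) : R.ofObj X ≫ R.toObj X = 𝟙 _ :=
  (R.isPullback_toObj X).lift_snd _ _ _

lemma ofObj_naturality {X Y : CatWG.{u} (m + 1)} (f : X ⟶ Y) :
    R.ofObj X ≫ (levZero m).map (R.F.map f) = (disc m).map ((objFun m).map f) ≫ R.ofObj Y := by
  apply (R.isPullback_toObj Y).hom_ext
  · have h : (levZero m).map (R.F.map f) ≫ (levZero m).map (R.V.app Y) =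
        (levZero m).map (R.V.app X) ≫ (levZero m).map f := map_square _ (R.V.naturality f)
    rw [Category.assoc, Category.assoc, h, ofObj_fst, ← Category.assoc, ofObj_fst]
    exact ((discAdj m).counit.naturality ((levZero m).map f)).symm
  · rw [Category.assoc, Category.assoc, toObj_naturality, ofObj_toObj, ← Category.assoc,
      ofObj_toObj, Category.id_comp, Category.comp_id]

/-- The discretization map of the discrete object on the set of objects of `X₀`. -/
def gammaObj (m : ℕ) : objFun.{u} m ⋙ disc m ⟶ (objFun m ⋙ disc m) ⋙ discretization m where
  app _ := gamma m _ (isDiscr_disc m _).isHomDisc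
  naturality _ _ _ := gamma_naturality _ _ _

instance (X : CatWG.{u} (m + 1)) : IsIso ((gammaObj m).app X) := isIso_gamma _ (isDiscr_disc m _)

/-- The section of the discretization map of `(F X)₀`. The classes of `(F X)₀` are the objects of
`X₀`, and each of these determines an object of `(F X)₀`. -/
def levZeroSection (X : CatWG.{u} (m + 1)) :
    (discretization m).obj ((levZero m).obj (R.F.obj X)) ⟶ (levZero m).obj (R.F.obj X) :=
  (discretization m).map (R.toObj X) ≫ inv ((gammaObj m).app X) ≫ R.ofObj X

lemma levZeroSection_gamma (X : CatWG.{u} (m + 1)) :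
    R.levZeroSection X ≫ gamma m _ (isHomDisc_levZero m (R.F.obj X)) = 𝟙 _ := by
  have h := gamma_naturality (isDiscr_disc m _).isHomDisc (isHomDisc_levZero m (R.F.obj X))
    (R.ofObj X)
  have h' : inv ((gammaObj m).app X) ≫ R.ofObj X ≫
      gamma m _ (isHomDisc_levZero m (R.F.obj X)) = (discretization m).map (R.ofObj X) :=
    (IsIso.inv_comp_eq _).2 h
  have := R.isIso_classes_toObj X
  have : IsIso ((discretization m).map (R.toObj X)) := isIso_map_of_isIso (disc m) this
  have h₁ : (discretization m).map (R.ofObj X) ≫ (discretization m).map (R.toObj X) = 𝟙 _ := by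
    rw [← Functor.map_comp, ofObj_toObj, CategoryTheory.Functor.map_id]
  rw [levZeroSection, Category.assoc, Category.assoc, h',
    ← cancel_mono ((discretization m).map (R.toObj X)), Category.assoc, h₁, Category.comp_id,
    Category.id_comp]

lemma levZeroSection_naturality {X Y : CatWG.{u} (m + 1)} (f : X ⟶ Y) :
    R.levZeroSection X ≫ (levZero m).map (R.F.map f) =
      (discretization m).map ((levZero m).map (R.F.map f)) ≫ R.levZeroSection Y :=
  (paste_two_squares (map_square (discretization m) (R.toObj_naturality f))
    (paste_two_squares (inv_square ((gammaObj m).naturality f)) (R.ofObj_naturality f).symm)).symm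

end Replacement

end

end WGlob

theorem mainTheorem6 (m : ℕ) :
    ∃ (F : WGlob.CatWG.{u} (m + 1) ⥤ WGlob.CatWG.{u} (m + 1)) (V : F ⟶ 𝟭 (WGlob.CatWG.{u} (m + 1))),
      (∀ X, WGlob.IsNEquiv (m + 1) (V.app X).hom) ∧
      (∀ X, WGlob.IsDiscreteObj (m + 1) X.obj →
        ∃ h : F.obj X = X, V.app X = eqToHom h) ∧
      (∀ {X Y Z : WGlob.CatWG.{u} (m + 1)} (f : X ⟶ Z) (g : Y ⟶ Z),
        WGlob.IsDiscreteObj (m + 1) Z.obj → PreservesLimit (cospan f g) F) ∧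
      (∃ s : ∀ X : WGlob.CatWG.{u} (m + 1),
          (WGlob.discretization m).obj ((WGlob.levZero m).obj (F.obj X)) ⟶
            (WGlob.levZero m).obj (F.obj X),
        (∀ X, s X ≫ WGlob.gamma m _ (WGlob.isHomDisc_levZero m (F.obj X)) = 𝟙 _) ∧
        ∀ {X Y : WGlob.CatWG.{u} (m + 1)} (f : X ⟶ Y),
          s X ≫ (WGlob.levZero m).map (F.map f) =
            (WGlob.discretization m).map ((WGlob.levZero m).map (F.map f)) ≫ s Y) := by
  obtain ⟨R, hR⟩ := WGlob.Replacement.exists_normalized.{u} (m := m)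
  exact ⟨R.F, R.V, R.isNEquiv, fun X h => hR X h.isDiscr,
    fun f g h => R.preservesLimit_cospan f g h.isDiscr, R.levZeroSection, R.levZeroSection_gamma,
    R.levZeroSection_naturality⟩
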